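/- Let $0<a<1$, $x\in\mathbb R$, $y>0$, $z=x+iy$, $q=e^{2\pi iz}$, and for complex $s$ write $q^s:=e^{2\pi isz}$. Put $$\vartheta_2=\sum_{n\in\mathbb Z}q^{(n+1/2)^2},\quad \vartheta_3=\sum_{n\in\mathbb Z}q^{n^2},\quad \vartheta_4=\sum_{n\in\mathbb Z}(-1)^nq^{n^2},\quad m(q)=\frac{\vartheta_2^2}{\vartheta_3^2},$$ and let $K=K(m(q))$ be the complete elliptic integral of the first kind with modulus $m(q)$, that is, the function of $z$, holomorphic on the upper half-plane, which for $0<q<1$ (i.e. $x=0$, where $0<m(q)<1$) equals $\frac{\pi}{2}\,{}_2F_1\left(\frac12,\frac12;1;m(q)^2\right)$; it is given by $K=\frac{\pi}{2}\vartheta_3^2$. Let $\mathrm{nd}(q,u)=1/\mathrm{dn}$ and $\mathrm{sd}(q,u)=\mathrm{sn}/\mathrm{dn}$ be the Jacobian elliptic functions of nome $q$: $$\mathrm{nd}(q,u)=\frac{\vartheta_3}{\vartheta_4}\,\frac{\vartheta_4(v)}{\vartheta_3(v)},\qquad \mathrm{sd}(q,u)=\frac{\vartheta_3^2}{\vartheta_2\vartheta_4}\,\frac{\vartheta_1(v)}{\vartheta_3(v)},\qquad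 v=\frac{\pi u}{2K},$$ where $\vartheta_1(v)=-i\sum_{n\in\mathbb Z}(-1)^nq^{(n+1/2)^2}e^{(2n+1)iv}$, $\vartheta_3(v)=\sum_{n\in\mathbb Z}q^{n^2}e^{2niv}$, $\vartheta_4(v)=\sum_{n\in\mathbb Z}(-1)^nq^{n^2}e^{2niv}$. Let $\theta(q,a)=2\sum_{n=0}^\infty\operatorname{arctanh}(q^{n+a})$ (a convergent series, with the principal branch of $\operatorname{arctanh}$) be the modular angle, and let $\theta_1=-K+(4a-2)xK$, $\theta_2=(4a-2)yK$, $\theta_0=\theta_1+i\theta_2$. Then $$q^a=iq^{1/2}e^{i\pi\theta_0/(2K)},$$ and $$\sum_{n=0}^\infty\frac{(-1)^nq^{n+1/2}}{(2n+1)(1-q^{2n+1})}\cos\left((2n+1)\frac{\pi}{2K}\theta_0\right)=\frac1{2i}\theta(q,a)+\frac1{4i}\log\bigl(\mathrm{nd}(q,\theta_0)+m(q)\,\mathrm{sd}(q,\theta_0)\bigr),$$ where the series converges and the logarithm is the value at $u=\theta_0$ of the branch of $\log\bigl(\mathrm{nd}(q,u)+m(q)\,\mathrm{sd}(q,u)\bigr)$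 obtained by continuation along the segment from $u=0$ to $u=\theta_0$, starting from the value $0$ at $u=0$. -/

import Mathlib

/-! Theta functions, the complete elliptic integral, Jacobian elliptic functions and the modular
angle, all attached to the nome `q = exp (2 π i z)` with `z` in the upper half-plane. Since
fractional powers of `q` occur, every function takes `z` itself as its argument. -/

namespace NomeJacobi

open Complex

/-- The power `q ^ s` of the nome `q = exp (2 π i z)`, taken as `exp (2 π i s z)`. -/
noncomputable def qpow (z s : ℂ) : ℂ := exp (2 * Real.pi * I * s * z)

/-- `ϑ₁(v, q) = -i ∑ (-1)^n q^{(n+1/2)^2} e^{(2n+1) i v}`, the sum over all integers. -/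
noncomputable def theta1 (z v : ℂ) : ℂ :=
  -I * ∑' n : ℤ, (-1 : ℂ) ^ n * qpow z (((n : ℂ) + 1 / 2) ^ 2) * exp ((2 * (n : ℂ) + 1) * I * v)

/-- `ϑ₃(v, q) = ∑ q^{n^2} e^{2 n i v}`, the sum over all integers. -/
noncomputable def theta3 (z v : ℂ) : ℂ :=
  ∑' n : ℤ, qpow z ((n : ℂ) ^ 2) * exp (2 * (n : ℂ) * I * v)

/-- `ϑ₄(v, q) = ∑ (-1)^n q^{n^2} e^{2 n i v}`, the sum over all integers. -/
noncomputable def theta4 (z v : ℂ) : ℂ :=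
  ∑' n : ℤ, (-1 : ℂ) ^ n * qpow z ((n : ℂ) ^ 2) * exp (2 * (n : ℂ) * I * v)

/-- The theta constant `ϑ₂(q) = ∑ q^{(n+1/2)^2}`. -/
noncomputable def theta2Null (z : ℂ) : ℂ := ∑' n : ℤ, qpow z (((n : ℂ) + 1 / 2) ^ 2)

/-- The theta constant `ϑ₃(q) = ∑ q^{n^2}`. -/
noncomputable def theta3Null (z : ℂ) : ℂ := ∑' n : ℤ, qpow z ((n : ℂ) ^ 2)

/-- The theta constant `ϑ₄(q) = ∑ (-1)^n q^{n^2}`. -/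
noncomputable def theta4Null (z : ℂ) : ℂ := ∑' n : ℤ, (-1 : ℂ) ^ n * qpow z ((n : ℂ) ^ 2)

/-- The modulus `m(q) = ϑ₂(q)^2 / ϑ₃(q)^2`. -/
noncomputable def modulus (z : ℂ) : ℂ := theta2Null z ^ 2 / theta3Null z ^ 2

/-- The complete elliptic integral `K = K(m(q)) = (π/2) ϑ₃(q)^2`. That this is the analytic
continuation of `(π/2) ₂F₁(1/2, 1/2; 1; m(q)^2)` from `0 < q < 1` is `IsCompleteEllipticIntegral`
below, which is asserted in the theorem and not taken for granted. -/
noncomputable def ellK (z : ℂ) : ℂ := Real.pi / 2 * theta3Null z ^ 2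

/-- `F`, as a function of `z`, is the complete elliptic integral `K(m(q))`: it is holomorphic on the
upper half-plane, and for `0 < q < 1` (that is, `z = i t` with `t > 0`) the modulus `k = m(q)` lies
in `(0, 1)` and `F` equals `(π/2) ₂F₁(1/2, 1/2; 1; k^2)`. -/
def IsCompleteEllipticIntegral (F : ℂ → ℂ) : Prop :=
  DifferentiableOn ℂ F {w : ℂ | 0 < w.im} ∧
    ∀ t : ℝ, 0 < t → ∃ k : ℝ, 0 < k ∧ k < 1 ∧ modulus (t * I) = k ∧
      F (t * I) =
        ((Real.pi / 2 * ordinaryHypergeometric (1 / 2 : ℝ) (1 / 2 : ℝ) (1 : ℝ) (k ^ 2) : ℝ) : ℂ)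

/-- Jacobi's `nd(q, u) = 1 / dn(q, u) = (ϑ₃ / ϑ₄) (ϑ₄(v) / ϑ₃(v))`, where `v = π u / (2 K)`. -/
noncomputable def nd (z u : ℂ) : ℂ :=
  theta3Null z / theta4Null z *
    (theta4 z (Real.pi * u / (2 * ellK z)) / theta3 z (Real.pi * u / (2 * ellK z)))

/-- Jacobi's `sd(q, u) = sn(q, u) / dn(q, u) = (ϑ₃^2 / (ϑ₂ ϑ₄)) (ϑ₁(v) / ϑ₃(v))`, where
`v = π u / (2 K)`. -/
noncomputable def sd (z u : ℂ) : ℂ :=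
  theta3Null z ^ 2 / (theta2Null z * theta4Null z) *
    (theta1 z (Real.pi * u / (2 * ellK z)) / theta3 z (Real.pi * u / (2 * ellK z)))

/-- The inverse hyperbolic tangent, principal branch for `|w| < 1`. -/
noncomputable def arctanh (w : ℂ) : ℂ := (log (1 + w) - log (1 - w)) / 2

/-- The modular angle `θ(q, a) = 2 ∑ arctanh (q^{n+a})`, `n = 0, 1, 2, …`. -/
noncomputable def modularAngle (z : ℂ) (a : ℝ) : ℂ :=
  2 * ∑' n : ℕ, arctanh (qpow z ((n : ℂ) + a))

/-- `L` is the value at `u` of `log f`, for the branch that is continued along the segment from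
`0` to `u` and vanishes at `0`. -/
def IsLogFromZero (f : ℂ → ℂ) (u L : ℂ) : Prop :=
  ∃ l : ℝ → ℂ, ContinuousOn l (Set.Icc 0 1) ∧ l 0 = 0 ∧ l 1 = L ∧
    ∀ t ∈ Set.Icc (0 : ℝ) 1, exp (l t) = f (t * u)

end NomeJacobi

/-! Put `v = π u / (2 K)`, `w_k(v) = i q^(k+1/2) e^(iv)` and `A(v) = ∑ arctanh (w_k(v))`; everything
takes place in the strip `|Im v| < π Im z`, where `|w_k(±v)| < 1`. Expanding each `arctanh` in
powers and summing the geometric series over `k` turns the Lambert cosine series into `(A(v) +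
A(-v)) / (2i)` (`hasSum_lambert`).

Let `H(v)` be `ϑ₃` of nome `q^(1/2)` at `v/2 - π/4` (`halfTheta`). The product formula
`jacobiTheta₂_mul` gives `H(v)^2 = ϑ₃ ϑ₄(v) + ϑ₂ ϑ₁(v)` and `H(v) H(-v) = ϑ₄ ϑ₃(v)`, so `nd + m sd =
H(v) / H(-v)`. The Jacobi triple product rewrites this quotient as `exp (2 (A(-v) - A(v)))`
(`halfTheta_div_neg`); the exponent is continuous on the strip and zero at `v = 0`, hence it is the
required branch of the logarithm.

At `u = θ₀` one has `v = (π/2)(-1 + (4a-2)z)`, which lies in the strip because `0 < a < 1`, and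
`w_k(v) = q^(k+a)`. The modular angle is therefore `2 A(v)`, and the identity is linear algebra in
`A(v)` and `A(-v)`.

That `(π/2) ϑ₃^2` is the complete elliptic integral rests on comparing two transformations: Gauss's
quadratic transformation of the hypergeometric function (`ellF_quadratic`) and Landen's for theta
constants. They make the ratio of `ϑ₃^2` to the hypergeometric value invariant under squaring the
nome, and the ratio tends to `1` as the nome tends to `0`. -/

namespace NomeJacobi

open Complex Filter Topology Finset

/-! ### The q-binomial theorem and the finite triple product. -/

/-- The finite `q`-Pochhammer product `(1 - Q) (1 - Q ^ 2) ⋯ (1 - Q ^ n)`. -/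
noncomputable def qFac (Q : ℂ) (n : ℕ) : ℂ := ∏ k ∈ range n, (1 - Q ^ (k + 1))

lemma qFac_succ (Q : ℂ) (n : ℕ) : qFac Q (n + 1) = qFac Q n * (1 - Q ^ (n + 1)) := by
  rw [qFac, prod_range_succ, ← qFac]

lemma one_sub_pow_succ_ne_zero {Q : ℂ} (hQ : ‖Q‖ < 1) (k : ℕ) : 1 - Q ^ (k + 1) ≠ 0 := by
  intro h
  have h1 : ‖Q ^ (k + 1)‖ < 1 := by
    rw [norm_pow]; exact pow_lt_one₀ (norm_nonneg _) hQ (by simp)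
  rw [← sub_eq_zero.mp h] at h1
  simp at h1

lemma qFac_ne_zero {Q : ℂ} (hQ : ‖Q‖ < 1) (n : ℕ) : qFac Q n ≠ 0 :=
  prod_ne_zero_iff.mpr fun k _ => one_sub_pow_succ_ne_zero hQ k

/-- The Gaussian binomial coefficient, as a quotient of `q`-Pochhammer products. -/
noncomputable def qBinom (Q : ℂ) (M j : ℕ) : ℂ :=
  if j ≤ M then qFac Q M / (qFac Q j * qFac Q (M - j)) else 0

lemma qBinom_zero_right {Q : ℂ} (hQ : ‖Q‖ < 1) (M : ℕ) : qBinom Q M 0 = 1 := by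
  have := qFac_ne_zero hQ M
  have h0 : qFac Q 0 = 1 := by simp [qFac]
  simp [qBinom, h0, this]

lemma qBinom_of_lt (Q : ℂ) {M j : ℕ} (h : M < j) : qBinom Q M j = 0 := by
  simp [qBinom, not_le.mpr h]

lemma qBinom_succ_succ {Q : ℂ} (hQ : ‖Q‖ < 1) {M j : ℕ} (hj : j ≤ M) :
    qBinom Q (M + 1) (j + 1) = qBinom Q M (j + 1) + Q ^ (M - j) * qBinom Q M j := by
  have hne := qFac_ne_zero hQ
  rcases hj.eq_or_lt with rfl | hlt
  · have h0 : qFac Q 0 = 1 := by simp [qFac]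
    rw [qBinom_of_lt Q (Nat.lt_succ_self j)]
    simp [qBinom, h0, hne]
  · obtain ⟨d, rfl⟩ := Nat.exists_eq_add_of_lt hlt
    have e1 : j + d + 1 + 1 - (j + 1) = d + 1 := by omega
    have e2 : j + d + 1 - (j + 1) = d := by omega
    have e3 : j + d + 1 - j = d + 1 := by omega
    have l1 : j + 1 ≤ j + d + 1 + 1 := by omega
    have l2 : j + 1 ≤ j + d + 1 := by omega
    simp only [qBinom, hj, l1, l2, if_true, e1, e2, e3]
    rw [qFac_succ Q (j + d + 1), qFac_succ Q j, qFac_succ Q d]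
    have a1 := hne j
    have a2 := hne d
    have a3 := one_sub_pow_succ_ne_zero hQ j
    have a4 := one_sub_pow_succ_ne_zero hQ d
    field_simp
    ring

/-- The `q`-binomial theorem. -/
theorem prod_one_add_pow_mul {Q : ℂ} (hQ : ‖Q‖ < 1) (x : ℂ) (M : ℕ) :
    ∏ k ∈ range M, (1 + Q ^ k * x) =
      ∑ j ∈ range (M + 1), qBinom Q M j * Q ^ (j.choose 2) * x ^ j := by
  induction M with
  | zero => simp [qBinom_zero_right hQ]
  | succ M ih =>
    rw [prod_range_succ, ih, sum_range_succ' _ (M + 1), mul_add, mul_one]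
    have h1 : ∑ j ∈ range (M + 1), qBinom Q M j * Q ^ (j.choose 2) * x ^ j =
        ∑ j ∈ range (M + 1), qBinom Q M (j + 1) * Q ^ ((j + 1).choose 2) * x ^ (j + 1) + 1 := by
      have h := sum_range_succ' (fun j => qBinom Q M j * Q ^ (j.choose 2) * x ^ j) (M + 1)
      rw [sum_range_succ, qBinom_of_lt Q (Nat.lt_succ_self M), zero_mul, zero_mul, add_zero] at h
      simpa [qBinom_zero_right hQ] using h
    have h2 : (∑ j ∈ range (M + 1), qBinom Q M j * Q ^ (j.choose 2) * x ^ j) * (Q ^ M * x) =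
        ∑ j ∈ range (M + 1), Q ^ (M - j) * qBinom Q M j * Q ^ ((j + 1).choose 2) * x ^ (j + 1) := by
      rw [sum_mul]
      refine sum_congr rfl fun j hj => ?_
      have hj' : j ≤ M := Nat.lt_succ_iff.mp (mem_range.mp hj)
      have hc : (j + 1).choose 2 = j + j.choose 2 := by
        rw [Nat.choose_succ_succ' j 1, Nat.choose_one_right]
      rw [hc, pow_add, pow_succ]
      nth_rewrite 2 [← Nat.sub_add_cancel hj']
      rw [pow_add]
      ring
    rw [h2]
    nth_rewrite 1 [h1]
    rw [add_right_comm, ← sum_add_distrib]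
    congr 1
    · refine sum_congr rfl fun j hj => ?_
      rw [qBinom_succ_succ hQ (Nat.lt_succ_iff.mp (mem_range.mp hj))]
      ring
    · simp [qBinom_zero_right hQ]

/-- The coefficients of the finite Jacobi triple product. -/
noncomputable def tripleCoeff (Q : ℂ) (N : ℕ) (n : ℤ) : ℂ :=
  if n ∈ Icc (-N : ℤ) N then qBinom Q (2 * N) (n + N).toNat else 0

/-- The finite Jacobi triple product. -/
theorem finite_triple_product {p w : ℂ} (hp0 : p ≠ 0) (hp : ‖p‖ < 1) (hw : w ≠ 0) (N : ℕ) :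
    ∏ k ∈ range N, ((1 + p ^ (2 * k + 1) * w) * (1 + p ^ (2 * k + 1) * w⁻¹)) =
      ∑' n : ℤ, tripleCoeff (p ^ 2) N n * (p ^ (n ^ 2) * w ^ n) := by
  have hQ : ‖p ^ 2‖ < 1 := by rw [norm_pow]; exact pow_lt_one₀ (norm_nonneg _) hp two_ne_zero
  -- The q-binomial theorem is applied with `2N` factors at `x = p^(1-2N) w`, so that the exponents
  -- of `p` run over the odd numbers from `1-2N` to `2N-1`. The negative half, reflected, yields the
  -- factors in `w⁻¹` once each `p^(-(2k+1)) w` is pulled out.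
  have hprod : ∏ k ∈ range (2 * N), (1 + (p ^ 2) ^ k * (p ^ (1 - 2 * N : ℤ) * w)) =
      p ^ (-(N : ℤ) ^ 2) * w ^ N *
        ∏ k ∈ range N, ((1 + p ^ (2 * k + 1) * w) * (1 + p ^ (2 * k + 1) * w⁻¹)) := by
    rw [two_mul, prod_range_add, prod_mul_distrib, ← prod_range_reflect]
    have e2 : ∏ k ∈ range N, (1 + (p ^ 2) ^ (N + k) * (p ^ (1 - 2 * N : ℤ) * w)) =
        ∏ k ∈ range N, (1 + p ^ (2 * k + 1) * w) := by
      refine prod_congr rfl fun k _ => ?_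
      rw [← mul_assoc, ← zpow_natCast, ← zpow_natCast, ← zpow_natCast, ← zpow_mul, ← zpow_add₀ hp0]
      congr 3
      push_cast
      ring
    have e1 : ∏ k ∈ range N, (1 + (p ^ 2) ^ (N - 1 - k) * (p ^ (1 - 2 * N : ℤ) * w)) =
        p ^ (-(N : ℤ) ^ 2) * w ^ N * ∏ k ∈ range N, (1 + p ^ (2 * k + 1) * w⁻¹) := by
      have : ∀ M : ℕ, ∏ k ∈ range M, (p ^ (-(2 * k + 1) : ℤ) * w) = p ^ (-(M : ℤ) ^ 2) * w ^ M := by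
        intro M
        induction M with
        | zero => simp
        | succ M ih =>
          rw [prod_range_succ, ih, pow_succ, mul_mul_mul_comm, ← zpow_add₀ hp0]
          congr 2
          push_cast
          ring
      rw [← this N, ← prod_mul_distrib]
      refine prod_congr rfl fun k hk => ?_
      have hk' := mem_range.mp hk
      have : p ^ (-(2 * k + 1) : ℤ) * p ^ (2 * k + 1) = 1 := by
        rw [← zpow_natCast, ← zpow_add₀ hp0]; simp
      rw [mul_add, mul_one, mul_mul_mul_comm, this, mul_inv_cancel₀ hw, one_mul, ← mul_assoc,
        add_comm]
      congr 2
      rw [← zpow_natCast, ← zpow_natCast, ← zpow_mul, ← zpow_add₀ hp0]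
      congr 1
      push_cast [Nat.cast_sub (show k ≤ N - 1 by omega), Nat.cast_sub (show 1 ≤ N by omega)]
      ring
    rw [e1, e2]
    ring
  have hsum : ∑' n : ℤ, tripleCoeff (p ^ 2) N n * (p ^ (n ^ 2) * w ^ n) =
      ∑ j ∈ range (2 * N + 1),
        qBinom (p ^ 2) (2 * N) j * (p ^ (((j : ℤ) - N) ^ 2) * w ^ ((j : ℤ) - N)) := by
    rw [tsum_eq_sum (s := Icc (-N : ℤ) N)
      (fun n hn => by rw [tripleCoeff, if_neg hn, zero_mul])]
    symm
    refine sum_bij (fun j _ => (j : ℤ) - N) ?_ ?_ ?_ ?_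
    · intro j hj
      have := mem_range.mp hj
      rw [mem_Icc]
      omega
    · intro i _ j _ h
      simpa using h
    · intro n hn
      have := mem_Icc.mp hn
      exact ⟨(n + N).toNat, mem_range.mpr (by omega), by omega⟩
    · intro j hj
      have := mem_range.mp hj
      rw [tripleCoeff, if_pos (mem_Icc.mpr (by omega))]
      simp
  have hunit : p ^ (-(N : ℤ) ^ 2) * w ^ N ≠ 0 :=
    mul_ne_zero (zpow_ne_zero _ hp0) (pow_ne_zero _ hw)
  rw [prod_one_add_pow_mul hQ] at hprod
  rw [hsum, ← mul_right_inj' hunit, ← hprod, mul_sum]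
  refine sum_congr rfl fun j _ => ?_
  have hw' : w ^ N * w ^ ((j : ℤ) - N) = w ^ j := by
    rw [← zpow_natCast, ← zpow_add₀ hw]; simp
  have hp' : p ^ (-(N : ℤ) ^ 2) * p ^ (((j : ℤ) - N) ^ 2) =
      (p ^ 2) ^ (j.choose 2) * (p ^ (1 - 2 * N : ℤ)) ^ j := by
    have hc : ((j.choose 2 : ℕ) : ℤ) * 2 = j * (j - 1) := by
      rcases j with _ | j
      · simp
      · have h2 := Nat.choose_two_right (j + 1)
        have h3 : (j + 1) * j / 2 * 2 = (j + 1) * j :=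
          Nat.div_mul_cancel (by rw [mul_comm]; exact (Nat.even_mul_succ_self j).two_dvd)
        rw [h2]
        simp only [Nat.add_sub_cancel]
        have : (((j + 1) * j / 2 * 2 : ℕ) : ℤ) = ((j + 1) * j : ℕ) := by rw [h3]
        push_cast at this ⊢
        rw [this]; ring
    rw [← zpow_natCast, ← zpow_natCast, ← zpow_natCast, ← zpow_mul, ← zpow_mul,
      ← zpow_add₀ hp0, ← zpow_add₀ hp0]
    congr 1
    push_cast
    linear_combination -hc
  rw [mul_pow]
  linear_combination (-(qBinom (p ^ 2) (2 * N) j) * w ^ j) * hp' -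
    (qBinom (p ^ 2) (2 * N) j) * p ^ (-(N : ℤ) ^ 2) * p ^ (((j : ℤ) - N) ^ 2) * hw'

/-! ### The infinite triple product and the nonvanishing of theta. -/

lemma exists_tendsto_prod_one_add {u : ℕ → ℂ} (hu : Summable u) (h0 : ∀ k, 1 + u k ≠ 0) :
    ∃ c : ℂ, c ≠ 0 ∧ Tendsto (fun N => ∏ k ∈ range N, (1 + u k)) atTop (𝓝 c) := by
  refine ⟨exp (∑' k, log (1 + u k)), exp_ne_zero _, ?_⟩
  have h := (summable_log_one_add_of_summable hu).hasSum.tendsto_sum_nat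
  refine ((continuous_exp.tendsto _).comp h).congr fun N => ?_
  rw [Function.comp_apply, exp_sum]
  exact prod_congr rfl fun k _ => exp_log (h0 k)

lemma exists_norm_le_of_tendsto {E : Type*} [NormedAddCommGroup E] {f : ℕ → E} {c : E}
    (h : Tendsto f atTop (𝓝 c)) : ∃ B : ℝ, ∀ n, ‖f n‖ ≤ B := by
  obtain ⟨B, hB⟩ := h.norm.bddAbove_range
  exact ⟨B, fun n => hB ⟨n, rfl⟩⟩

lemma exists_tendsto_qFac {Q : ℂ} (hQ : ‖Q‖ < 1) :
    ∃ c : ℂ, c ≠ 0 ∧ Tendsto (qFac Q) atTop (𝓝 c) := by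
  have hg := (summable_nat_add_iff (f := fun k : ℕ => Q ^ k) 1).mpr
    (summable_geometric_of_norm_lt_one hQ)
  have hs : Summable fun k : ℕ => -Q ^ (k + 1) := hg.neg
  obtain ⟨c, hc, h⟩ := exists_tendsto_prod_one_add hs fun k => by
    rw [← sub_eq_add_neg]; exact one_sub_pow_succ_ne_zero hQ k
  exact ⟨c, hc, h.congr fun N => prod_congr rfl fun k _ => (sub_eq_add_neg _ _).symm⟩

/-- Both `qFac Q` and its inverse converge, hence are bounded. Uniformity in `N` and `n` supplies
the majorant for dominated convergence in the triple product. -/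
lemma exists_norm_tripleCoeff_le {Q : ℂ} (hQ : ‖Q‖ < 1) :
    ∃ B : ℝ, ∀ N n, ‖tripleCoeff Q N n‖ ≤ B := by
  obtain ⟨c, hc, h⟩ := exists_tendsto_qFac hQ
  obtain ⟨B, hB⟩ := exists_norm_le_of_tendsto h
  obtain ⟨C, hC⟩ := exists_norm_le_of_tendsto (h.inv₀ hc)
  have hB0 : 0 ≤ B := (norm_nonneg _).trans (hB 0)
  have hC0 : 0 ≤ C := (norm_nonneg _).trans (hC 0)
  refine ⟨B * (C * C), fun N n => ?_⟩
  rw [tripleCoeff]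
  split_ifs
  · rw [qBinom]
    split_ifs
    · rw [div_eq_mul_inv, mul_inv, norm_mul, norm_mul]
      exact mul_le_mul (hB _) (mul_le_mul (hC _) (hC _) (norm_nonneg _) hC0) (by positivity) hB0
    · rw [norm_zero]; positivity
  · rw [norm_zero]; positivity

/-- Once `N ≥ |n|` the coefficient is a genuine quotient of three `qFac` values with indices `2N`,
`N + n`, `N - n`, all tending to infinity, so the limit is `c / (c * c)`. -/
lemma tendsto_tripleCoeff {Q c : ℂ} (hc : c ≠ 0) (h : Tendsto (qFac Q) atTop (𝓝 c)) (n : ℤ) :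
    Tendsto (fun N => tripleCoeff Q N n) atTop (𝓝 c⁻¹) := by
  have h1 : Tendsto (fun N : ℕ => qFac Q (2 * N) / (qFac Q (n + N).toNat *
      qFac Q (N - n).toNat)) atTop (𝓝 (c / (c * c))) := by
    refine (h.comp ?_).div ((h.comp ?_).mul (h.comp ?_)) (mul_ne_zero hc hc)
    · exact tendsto_atTop_mono (fun N => Nat.le_mul_of_pos_left N two_pos) tendsto_id
    · refine tendsto_atTop.mpr fun b => ?_
      filter_upwards [eventually_ge_atTop (b + n.natAbs)] with N hN
      omega
    · refine tendsto_atTop.mpr fun b => ?_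
      filter_upwards [eventually_ge_atTop (b + n.natAbs)] with N hN
      omega
  have e : c / (c * c) = c⁻¹ := by field_simp
  rw [e] at h1
  refine h1.congr' ?_
  filter_upwards [eventually_ge_atTop n.natAbs] with N hN
  rw [tripleCoeff, if_pos (mem_Icc.mpr (by omega)), qBinom, if_pos (by omega)]
  congr 3
  omega

lemma norm_exp_pi_mul_I_lt_one {τ : ℂ} (hτ : 0 < τ.im) : ‖exp (Real.pi * I * τ)‖ < 1 := by
  rw [norm_exp, Real.exp_lt_one_iff]
  simpa using mul_pos Real.pi_pos hτ

lemma jacobiTheta₂_term_eq (n : ℤ) (u τ : ℂ) :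
    jacobiTheta₂_term n u τ =
      exp (Real.pi * I * τ) ^ (n ^ 2) * exp (2 * Real.pi * I * u) ^ n := by
  rw [jacobiTheta₂_term, ← exp_int_mul, ← exp_int_mul, ← exp_add]
  congr 1
  push_cast
  ring

/-- The Jacobi triple product, up to a nonzero constant factor. -/
theorem exists_tendsto_triple_product {τ : ℂ} (hτ : 0 < τ.im) :
    ∃ c : ℂ, c ≠ 0 ∧ ∀ u : ℂ, Tendsto (fun N => ∏ k ∈ range N,
      ((1 + exp (Real.pi * I * τ) ^ (2 * k + 1) * exp (2 * Real.pi * I * u)) *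
        (1 + exp (Real.pi * I * τ) ^ (2 * k + 1) * (exp (2 * Real.pi * I * u))⁻¹)))
      atTop (𝓝 (c * jacobiTheta₂ u τ)) := by
  have hp := norm_exp_pi_mul_I_lt_one hτ
  set p := exp (Real.pi * I * τ) with hpdef
  have hp0 : p ≠ 0 := exp_ne_zero _
  have hQ : ‖p ^ 2‖ < 1 := by rw [norm_pow]; exact pow_lt_one₀ (norm_nonneg _) hp two_ne_zero
  obtain ⟨c, hc, h⟩ := exists_tendsto_qFac hQ
  obtain ⟨B, hB⟩ := exists_norm_tripleCoeff_le hQ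
  refine ⟨c⁻¹, inv_ne_zero hc, fun u => ?_⟩
  simp_rw [finite_triple_product hp0 hp (exp_ne_zero (2 * Real.pi * I * u)), hpdef,
    ← jacobiTheta₂_term_eq, ← hpdef]
  rw [jacobiTheta₂, ← tsum_mul_left]
  refine tendsto_tsum_of_dominated_convergence
    (bound := fun n => B * ‖jacobiTheta₂_term n u τ‖)
    (((summable_jacobiTheta₂_term_iff u τ).mpr hτ).norm.mul_left B) (fun n => ?_)
    (Eventually.of_forall fun N n => ?_)
  · exact (tendsto_tripleCoeff hc h n).mul_const _
  · rw [norm_mul]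
    exact mul_le_mul_of_nonneg_right (hB N n) (norm_nonneg _)

/-- The theta function does not vanish where the factors of its triple product do not. -/
theorem jacobiTheta₂_ne_zero {τ u : ℂ} (hu : |u.im| < τ.im / 2) : jacobiTheta₂ u τ ≠ 0 := by
  have hτ : 0 < τ.im := by have := abs_nonneg u.im; linarith
  obtain ⟨c, hc, h⟩ := exists_tendsto_triple_product hτ
  have hp := norm_exp_pi_mul_I_lt_one hτ
  have hb := abs_lt.mp hu
  have hnorm : ∀ (v : ℂ), -(τ.im / 2) < v.im → ∀ k : ℕ,
      ‖exp (Real.pi * I * τ) ^ (2 * k + 1) * exp (2 * Real.pi * I * v)‖ < 1 := by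
    intro v hv k
    have : ‖exp (Real.pi * I * τ) * exp (2 * Real.pi * I * v)‖ < 1 := by
      rw [← exp_add, norm_exp, Real.exp_lt_one_iff]
      have : 0 < Real.pi * (τ.im + 2 * v.im) := mul_pos Real.pi_pos (by linarith)
      simp
      linarith
    -- One factor `p` is enough to absorb the growth of the exponential; the remaining `p^(2k)` has
    -- norm at most `1`.
    rw [pow_succ, mul_assoc, norm_mul, norm_pow]
    exact mul_lt_one_of_nonneg_of_lt_one_right (pow_le_one₀ (norm_nonneg _) hp.le)
      (norm_nonneg _) this
  have hne : ∀ v : ℂ, -(τ.im / 2) < v.im → ∀ k : ℕ,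
      1 + exp (Real.pi * I * τ) ^ (2 * k + 1) * exp (2 * Real.pi * I * v) ≠ 0 := by
    intro v hv k h0
    have h1 := hnorm v hv k
    rw [← norm_neg, ← eq_neg_of_add_eq_zero_left h0, norm_one] at h1
    exact lt_irrefl _ h1
  have hs : Summable fun k : ℕ => exp (Real.pi * I * τ) ^ (2 * k + 1) := by
    refine (summable_geometric_of_norm_lt_one hp).comp_injective fun a b hab => ?_
    simpa using hab
  have hinv : (exp (2 * Real.pi * I * u))⁻¹ = exp (2 * Real.pi * I * (-u)) := by
    rw [← exp_neg, mul_neg]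
  obtain ⟨c1, hc1, h1⟩ := exists_tendsto_prod_one_add
    (hs.mul_right (exp (2 * Real.pi * I * u))) (hne u hb.1)
  obtain ⟨c2, hc2, h2⟩ := exists_tendsto_prod_one_add
    (hs.mul_right (exp (2 * Real.pi * I * (-u)))) (hne (-u) (by rw [neg_im]; linarith))
  have h3 := h u
  rw [hinv] at h3
  simp_rw [prod_mul_distrib] at h3
  have := tendsto_nhds_unique h3 (h1.mul h2)
  intro h0
  rw [h0, mul_zero] at this
  exact mul_ne_zero hc1 hc2 this.symm

/-! ### Products of theta functions by splitting a lattice. -/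

/-- The lattice `ℤ × ℤ`, split according to the parity of the sum of the coordinates. -/
def parityEquiv : (ℤ × ℤ) ⊕ (ℤ × ℤ) ≃ ℤ × ℤ where
  toFun := Sum.elim (fun x => (x.1 + x.2, x.1 - x.2)) (fun x => (x.1 + x.2 + 1, x.1 - x.2))
  -- In the odd class the sum and the difference of the coordinates are `2s + 1` and `2d + 1`; floor
  -- division recovers `s` and `d`.
  invFun x := if (x.1 + x.2) % 2 = 0 then Sum.inl ((x.1 + x.2) / 2, (x.1 - x.2) / 2)
    else Sum.inr ((x.1 + x.2) / 2, (x.1 - x.2) / 2)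
  left_inv := by
    rintro (⟨s, d⟩ | ⟨s, d⟩)
    · have h : (s + d + (s - d)) % 2 = 0 := by omega
      simp only [Sum.elim_inl, h, if_true, Sum.inl.injEq, Prod.mk.injEq]
      omega
    · have h : ¬ (s + d + 1 + (s - d)) % 2 = 0 := by omega
      simp only [Sum.elim_inr, h, if_false, Sum.inr.injEq, Prod.mk.injEq]
      omega
  right_inv := by
    rintro ⟨m, n⟩
    by_cases h : (m + n) % 2 = 0
    · simp only [h, if_true, Sum.elim_inl, Prod.mk.injEq]
      omega
    · simp only [h, if_false, Sum.elim_inr, Prod.mk.injEq]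
      omega

/-- The product of two theta functions in terms of theta functions at `2 * τ`. -/
theorem jacobiTheta₂_mul (a b : ℂ) {τ : ℂ} (hτ : 0 < τ.im) :
    jacobiTheta₂ a τ * jacobiTheta₂ b τ =
      jacobiTheta₂ (a + b) (2 * τ) * jacobiTheta₂ (a - b) (2 * τ) +
        exp (Real.pi * I * (2 * a + τ)) *
          (jacobiTheta₂ (a + b + τ) (2 * τ) * jacobiTheta₂ (a - b + τ) (2 * τ)) := by
  have hτ2 : 0 < (2 * τ).im := by simpa using hτ
  have hn : ∀ u, Summable fun n => ‖jacobiTheta₂_term n u τ‖ := fun u =>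
    ((summable_jacobiTheta₂_term_iff u τ).mpr hτ).norm
  have hn2 : ∀ u, Summable fun n => ‖jacobiTheta₂_term n u (2 * τ)‖ := fun u =>
    ((summable_jacobiTheta₂_term_iff u (2 * τ)).mpr hτ2).norm
  simp only [jacobiTheta₂]
  rw [tsum_mul_tsum_of_summable_norm (hn a) (hn b), ← parityEquiv.tsum_eq,
    tsum_mul_tsum_of_summable_norm (hn2 _) (hn2 _), tsum_mul_tsum_of_summable_norm (hn2 _) (hn2 _),
    ← tsum_mul_left]
  have hs : Summable fun c => jacobiTheta₂_term (parityEquiv c).1 a τ *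
      jacobiTheta₂_term (parityEquiv c).2 b τ :=
    parityEquiv.summable_iff.mpr (summable_mul_of_summable_norm (hn a) (hn b))
  rw [Summable.tsum_sum (hs.comp_injective Sum.inl_injective)
    (hs.comp_injective Sum.inr_injective)]
  congr 1
  · refine tsum_congr fun x => ?_
    simp only [parityEquiv, Equiv.coe_fn_mk, Sum.elim_inl, jacobiTheta₂_term, ← exp_add]
    congr 1
    push_cast
    ring
  · refine tsum_congr fun x => ?_
    simp only [parityEquiv, Equiv.coe_fn_mk, Sum.elim_inr, jacobiTheta₂_term, ← exp_add]
    congr 1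
    push_cast
    ring

/-! ### Sums of inverse hyperbolic tangents and the Lambert series. -/

lemma hasSum_arctanh {w : ℂ} (hw : ‖w‖ < 1) :
    HasSum (fun n : ℕ => w ^ (2 * n + 1) / (2 * (n : ℂ) + 1)) (arctanh w) := by
  have hw' : ‖-w‖ < 1 := by rwa [norm_neg]
  have h := ((hasSum_taylorSeries_log hw).sub (hasSum_taylorSeries_log hw')).div_const 2
  rw [← sub_eq_add_neg] at h
  change HasSum _ (arctanh w) at h
  have hinj : Function.Injective fun n : ℕ => 2 * n + 1 := fun a b hab => by simpa using hab
  rw [← hinj.hasSum_iff] at h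
  · refine h.congr_fun fun n => ?_
    have h1 : (-1 : ℂ) ^ (2 * n + 1 + 1) = 1 := Even.neg_one_pow ⟨n + 1, by ring⟩
    have h2 : (-w) ^ (2 * n + 1) = -w ^ (2 * n + 1) := Odd.neg_pow ⟨n, rfl⟩ w
    simp only [Function.comp_apply, h1, h2]
    push_cast
    ring
  · intro m hm
    have hm' : Even m := by
      rw [← Nat.not_odd_iff_even]
      rintro ⟨k, rfl⟩
      exact hm ⟨k, rfl⟩
    rw [hm'.neg_pow]
    simp

/-- A bound linear in `‖w‖`, with a constant uniform on the disc of radius `r`, lets the geometric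
decay of `nomeArg` pass to its `arctanh`. -/
lemma norm_arctanh_le {r : ℝ} {w : ℂ} (hw : ‖w‖ ≤ r) (hr : r < 1) :
    ‖arctanh w‖ ≤ (1 - r)⁻¹ * ‖w‖ := by
  have hr0 : 0 ≤ r := (norm_nonneg _).trans hw
  have hg := (hasSum_geometric_of_lt_one hr0 hr).mul_right ‖w‖
  rw [← (hasSum_arctanh (hw.trans_lt hr)).tsum_eq]
  refine tsum_of_norm_bounded hg fun n => ?_
  have h1 : 1 ≤ ‖(2 * (n : ℂ) + 1)‖ := by
    have : (2 * (n : ℂ) + 1) = ((2 * n + 1 : ℕ) : ℂ) := by push_cast; ring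
    rw [this, Complex.norm_natCast]
    exact_mod_cast Nat.le_add_left 1 _
  rw [norm_div, norm_pow]
  refine (div_le_self (by positivity) h1).trans ?_
  rw [pow_succ]
  refine mul_le_mul_of_nonneg_right ?_ (norm_nonneg _)
  calc ‖w‖ ^ (2 * n) ≤ r ^ (2 * n) := by gcongr
    _ ≤ r ^ n := pow_le_pow_of_le_one hr0 hr.le (by omega)

lemma exp_two_mul_arctanh {w : ℂ} (hw : ‖w‖ < 1) :
    exp (2 * arctanh w) = (1 + w) / (1 - w) := by
  have h1 : 1 + w ≠ 0 := by
    intro h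
    rw [← norm_neg, ← eq_neg_of_add_eq_zero_left h, norm_one] at hw
    exact lt_irrefl _ hw
  have h2 : 1 - w ≠ 0 := by
    intro h
    rw [← sub_eq_zero.mp h, norm_one] at hw
    exact lt_irrefl _ hw
  rw [arctanh, mul_div_cancel₀ _ (two_ne_zero' ℂ), exp_sub, exp_log h1, exp_log h2]

/-- The argument `i q ^ (k + 1 / 2) e ^ (i v)` of the inverse hyperbolic tangents whose sum is the
logarithm of `nd + k sd`. -/
noncomputable def nomeArg (z v : ℂ) (k : ℕ) : ℂ := I * qpow z ((k : ℂ) + 1 / 2) * exp (I * v)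

lemma nomeArg_eq (z v : ℂ) (k : ℕ) :
    nomeArg z v k = I * exp (Real.pi * I * z) ^ (2 * k + 1) * exp (I * v) := by
  rw [nomeArg, qpow, ← exp_nat_mul]
  congr 3
  push_cast
  ring

lemma norm_nomeArg_le {z v : ℂ} {S : ℝ} (hv : |v.im| ≤ S) (k : ℕ) :
    ‖nomeArg z v k‖ ≤ Real.exp (S - Real.pi * z.im) * Real.exp (-2 * Real.pi * z.im) ^ k := by
  rw [nomeArg_eq, ← exp_nat_mul, mul_assoc, norm_mul, norm_I, one_mul, ← exp_add, norm_exp,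
    ← Real.exp_nat_mul, ← Real.exp_add, Real.exp_le_exp]
  have := (abs_le.mp hv).1
  simp
  linarith

/-- The sum of the inverse hyperbolic tangents of `i q ^ (k + 1 / 2) e ^ (i v)`. -/
noncomputable def arctanhSum (z v : ℂ) : ℂ := ∑' k, arctanh (nomeArg z v k)

section Strip

variable {z : ℂ} {S : ℝ}

lemma exp_sub_lt_one (hS : S < Real.pi * z.im) : Real.exp (S - Real.pi * z.im) < 1 := by
  rw [Real.exp_lt_one_iff]; linarith

lemma exp_neg_two_pi_lt_one (hz : 0 < z.im) : Real.exp (-2 * Real.pi * z.im) < 1 := by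
  rw [Real.exp_lt_one_iff]; have := mul_pos Real.pi_pos hz; linarith

lemma norm_nomeArg_le' (hz : 0 < z.im) {v : ℂ} (hv : |v.im| ≤ S) (k : ℕ) :
    ‖nomeArg z v k‖ ≤ Real.exp (S - Real.pi * z.im) :=
  (norm_nomeArg_le hv k).trans <| mul_le_of_le_one_right (Real.exp_nonneg _) <|
    pow_le_one₀ (Real.exp_nonneg _) (exp_neg_two_pi_lt_one hz).le

lemma norm_arctanh_nomeArg_le (hz : 0 < z.im) (hS : S < Real.pi * z.im) {v : ℂ} (hv : |v.im| ≤ S)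
    (k : ℕ) : ‖arctanh (nomeArg z v k)‖ ≤ (1 - Real.exp (S - Real.pi * z.im))⁻¹ *
      (Real.exp (S - Real.pi * z.im) * Real.exp (-2 * Real.pi * z.im) ^ k) := by
  refine (norm_arctanh_le (norm_nomeArg_le' hz hv k) (exp_sub_lt_one hS)).trans ?_
  refine mul_le_mul_of_nonneg_left (norm_nomeArg_le hv k) (inv_nonneg.mpr ?_)
  have := exp_sub_lt_one hS
  linarith

lemma summable_arctanh_bound (hz : 0 < z.im) :
    Summable fun k : ℕ => (1 - Real.exp (S - Real.pi * z.im))⁻¹ *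
      (Real.exp (S - Real.pi * z.im) * Real.exp (-2 * Real.pi * z.im) ^ k) :=
  ((summable_geometric_of_lt_one (Real.exp_nonneg _) (exp_neg_two_pi_lt_one hz)).mul_left
    _).mul_left _

lemma summable_arctanh_nomeArg (hz : 0 < z.im) (hS : S < Real.pi * z.im) {v : ℂ}
    (hv : |v.im| ≤ S) : Summable fun k => arctanh (nomeArg z v k) :=
  (summable_arctanh_bound hz).of_norm_bounded fun k => norm_arctanh_nomeArg_le hz hS hv k

/-- Weierstrass M-test. Each term is continuous because `|w_k| < 1` keeps `1 ± w_k` in the slit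
plane, so the principal logarithms never meet their cut. -/
lemma continuousOn_arctanhSum (hz : 0 < z.im) (hS : S < Real.pi * z.im) :
    ContinuousOn (arctanhSum z) {v | |v.im| ≤ S} := by
  refine continuousOn_tsum (fun k => ?_) (summable_arctanh_bound hz) fun k v hv =>
    norm_arctanh_nomeArg_le hz hS hv k
  have hc : Continuous fun v => nomeArg z v k := by unfold nomeArg; fun_prop
  have hlt : ∀ v ∈ {v : ℂ | |v.im| ≤ S}, ‖nomeArg z v k‖ < 1 := fun v hv =>
    (norm_nomeArg_le' hz hv k).trans_lt (exp_sub_lt_one hS)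
  have h1 : ContinuousOn (fun v => log (1 + nomeArg z v k)) {v | |v.im| ≤ S} :=
    ContinuousOn.clog (by fun_prop) fun v hv => mem_slitPlane_of_norm_lt_one (hlt v hv)
  have h2 : ContinuousOn (fun v => log (1 - nomeArg z v k)) {v | |v.im| ≤ S} :=
    ContinuousOn.clog (by fun_prop) fun v hv => by
      rw [sub_eq_add_neg]
      exact mem_slitPlane_of_norm_lt_one (by rw [norm_neg]; exact hlt v hv)
  exact (h1.sub h2).div_const 2

/-- Geometric series in `k` with ratio `q^(2n+1)`; the sign comes from `i^(2n+1) = i (-1)^n`. -/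
lemma hasSum_nomeArg_pow (hz : 0 < z.im) (v : ℂ) (n : ℕ) :
    HasSum (fun k => nomeArg z v k ^ (2 * n + 1) / (2 * (n : ℂ) + 1))
      (I * (-1) ^ n * qpow z ((n : ℂ) + 1 / 2) /
        ((2 * (n : ℂ) + 1) * (1 - qpow z (2 * (n : ℂ) + 1))) *
          exp ((2 * (n : ℂ) + 1) * (I * v))) := by
  have hn : ‖qpow z (2 * (n : ℂ) + 1)‖ < 1 := by
    rw [qpow, norm_exp, Real.exp_lt_one_iff]
    have h1 : 0 < Real.pi * z.im * (2 * n + 1) := by have := Real.pi_pos; positivity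
    have e : (2 * Real.pi * I * (2 * (n : ℂ) + 1) * z).re =
        -2 * (Real.pi * z.im * (2 * n + 1)) := by
      simp
      ring
    rw [e]
    linarith
  have h := (hasSum_geometric_of_norm_lt_one hn).mul_left
    (I * (-1) ^ n * qpow z ((n : ℂ) + 1 / 2) / (2 * (n : ℂ) + 1) *
      exp ((2 * (n : ℂ) + 1) * (I * v)))
  have e : I * (-1) ^ n * qpow z ((n : ℂ) + 1 / 2) /
      ((2 * (n : ℂ) + 1) * (1 - qpow z (2 * (n : ℂ) + 1))) * exp ((2 * (n : ℂ) + 1) * (I * v)) =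
      I * (-1) ^ n * qpow z ((n : ℂ) + 1 / 2) / (2 * (n : ℂ) + 1) *
        exp ((2 * (n : ℂ) + 1) * (I * v)) * (1 - qpow z (2 * (n : ℂ) + 1))⁻¹ := by
    rw [div_eq_mul_inv, div_eq_mul_inv, mul_inv]
    ring
  rw [e]
  refine h.congr_fun fun k => ?_
  have hI : I ^ (2 * n + 1) = I * (-1) ^ n := by rw [pow_succ, pow_mul, I_sq]; ring
  have he : exp (I * v) ^ (2 * n + 1) = exp ((2 * (n : ℂ) + 1) * (I * v)) := by
    rw [← exp_nat_mul]; congr 1; push_cast; ring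
  have hq : qpow z ((k : ℂ) + 1 / 2) ^ (2 * n + 1) =
      qpow z ((n : ℂ) + 1 / 2) * qpow z (2 * (n : ℂ) + 1) ^ k := by
    simp only [qpow, ← exp_nat_mul, ← exp_add]; congr 1; push_cast; ring
  rw [nomeArg, mul_pow, mul_pow, hI, he, hq]
  ring

/-- The double series is dominated by the product of two geometric series, which justifies
exchanging the order of summation. -/
lemma summable_nomeArg_pow (hz : 0 < z.im) (hS : S < Real.pi * z.im) {v : ℂ}
    (hv : |v.im| ≤ S) :
    Summable fun x : ℕ × ℕ => nomeArg z v x.1 ^ (2 * x.2 + 1) / (2 * (x.2 : ℂ) + 1) := by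
  set r := Real.exp (S - Real.pi * z.im) with hr
  set ρ := Real.exp (-2 * Real.pi * z.im) with hρ
  have hr1 : r < 1 := exp_sub_lt_one hS
  have hρ1 : ρ < 1 := exp_neg_two_pi_lt_one hz
  have hr0 : 0 ≤ r := Real.exp_nonneg _
  have hρ0 : 0 ≤ ρ := Real.exp_nonneg _
  have hb : Summable fun x : ℕ × ℕ => ρ ^ x.1 * r ^ x.2 :=
    (summable_geometric_of_lt_one hρ0 hρ1).mul_of_nonneg (summable_geometric_of_lt_one hr0 hr1)
      (fun _ => by positivity) (fun _ => by positivity)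
  refine hb.of_norm_bounded fun x => ?_
  have h1 : 1 ≤ ‖(2 * (x.2 : ℂ) + 1)‖ := by
    have : (2 * (x.2 : ℂ) + 1) = ((2 * x.2 + 1 : ℕ) : ℂ) := by push_cast; ring
    rw [this, Complex.norm_natCast]
    exact_mod_cast Nat.le_add_left 1 _
  rw [norm_div, norm_pow]
  refine (div_le_self (by positivity) h1).trans ?_
  calc ‖nomeArg z v x.1‖ ^ (2 * x.2 + 1) ≤ (r * ρ ^ x.1) ^ (2 * x.2 + 1) := by
        gcongr; exact norm_nomeArg_le hv x.1
    _ = r ^ (2 * x.2 + 1) * ρ ^ (x.1 * (2 * x.2 + 1)) := by rw [mul_pow, pow_mul]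
    _ ≤ r ^ x.2 * ρ ^ x.1 := by
        refine mul_le_mul (pow_le_pow_of_le_one hr0 hr1.le (by omega))
          (pow_le_pow_of_le_one hρ0 hρ1.le (Nat.le_mul_of_pos_right _ (by omega)))
          (by positivity) (by positivity)
    _ = ρ ^ x.1 * r ^ x.2 := mul_comm _ _

lemma hasSum_tsum_comm {F : ℕ → ℕ → ℂ} {f g : ℕ → ℂ}
    (hs : Summable fun x : ℕ × ℕ => F x.1 x.2)
    (hf : ∀ k, HasSum (fun n => F k n) (f k)) (hg : ∀ n, HasSum (fun k => F k n) (g n)) :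
    HasSum g (∑' k, f k) := by
  rw [(hs.hasSum.prod_fiberwise hf).tsum_eq]
  exact ((Equiv.prodComm ℕ ℕ).hasSum_iff.mpr hs.hasSum).prod_fiberwise hg

lemma hasSum_arctanhSum (hz : 0 < z.im) (hS : S < Real.pi * z.im) {v : ℂ} (hv : |v.im| ≤ S) :
    HasSum (fun n : ℕ => I * (-1) ^ n * qpow z ((n : ℂ) + 1 / 2) /
        ((2 * (n : ℂ) + 1) * (1 - qpow z (2 * (n : ℂ) + 1))) * exp ((2 * (n : ℂ) + 1) * (I * v)))
      (arctanhSum z v) := by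
  have hf : ∀ k, HasSum (fun n : ℕ => nomeArg z v k ^ (2 * n + 1) / (2 * (n : ℂ) + 1))
      (arctanh (nomeArg z v k)) := fun k =>
    hasSum_arctanh ((norm_nomeArg_le' hz hv k).trans_lt (exp_sub_lt_one hS))
  have hg := fun n => hasSum_nomeArg_pow hz v n
  have hs := summable_nomeArg_pow hz hS hv
  exact hasSum_tsum_comm (F := fun k n => nomeArg z v k ^ (2 * n + 1) / (2 * (n : ℂ) + 1))
    (f := fun k => arctanh (nomeArg z v k)) hs hf hg

/-- The Lambert series as a sum of inverse hyperbolic tangents. -/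
theorem hasSum_lambert (hz : 0 < z.im) {v : ℂ} (hv : |v.im| < Real.pi * z.im) :
    HasSum (fun n : ℕ => (-1 : ℂ) ^ n * qpow z ((n : ℂ) + 1 / 2) /
        ((2 * (n : ℂ) + 1) * (1 - qpow z (2 * (n : ℂ) + 1))) * cos ((2 * (n : ℂ) + 1) * v))
      ((arctanhSum z v + arctanhSum z (-v)) / (2 * I)) := by
  have h1 := hasSum_arctanhSum hz hv (v := v) le_rfl
  have h2 := hasSum_arctanhSum hz hv (v := -v) (by rw [neg_im, abs_neg])
  refine ((h1.add h2).div_const (2 * I)).congr_fun fun n => ?_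
  have e1 : exp ((2 * (n : ℂ) + 1) * v * I) = exp ((2 * (n : ℂ) + 1) * (I * v)) := by
    congr 1; ring
  have e2 : exp (-((2 * (n : ℂ) + 1) * v) * I) = exp ((2 * (n : ℂ) + 1) * (I * -v)) := by
    congr 1; ring
  rw [cos, e1, e2]
  have hI := I_ne_zero
  field_simp

end Strip

/-! ### Theta functions in terms of Mathlib's two-variable theta function -/

lemma exp_int_mul_pi_mul_I (n : ℤ) : exp (n * (Real.pi * I)) = (-1) ^ n := by
  rw [exp_int_mul, exp_pi_mul_I]

lemma theta3_eq (z v : ℂ) : theta3 z v = jacobiTheta₂ (v / Real.pi) (2 * z) := by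
  rw [theta3, jacobiTheta₂]
  refine tsum_congr fun n => ?_
  have hpi : (Real.pi : ℂ) ≠ 0 := ofReal_ne_zero.mpr Real.pi_ne_zero
  rw [qpow, jacobiTheta₂_term, ← exp_add]
  congr 1
  field_simp
  ring

lemma theta4_eq (z v : ℂ) : theta4 z v = jacobiTheta₂ (v / Real.pi + 1 / 2) (2 * z) := by
  refine tsum_congr fun n => ?_
  have hpi : (Real.pi : ℂ) ≠ 0 := ofReal_ne_zero.mpr Real.pi_ne_zero
  rw [qpow, jacobiTheta₂_term, ← exp_int_mul_pi_mul_I, ← exp_add, ← exp_add]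
  congr 1
  field_simp
  ring

lemma theta1_eq (z v : ℂ) : theta1 z v = -I * (exp (Real.pi * I * z / 2) * exp (I * v)) *
    jacobiTheta₂ (v / Real.pi + z + 1 / 2) (2 * z) := by
  rw [theta1, jacobiTheta₂, ← tsum_mul_left, ← tsum_mul_left]
  refine tsum_congr fun n => ?_
  rw [mul_assoc (-I)]
  congr 1
  have hpi : (Real.pi : ℂ) ≠ 0 := ofReal_ne_zero.mpr Real.pi_ne_zero
  rw [qpow, jacobiTheta₂_term, ← exp_int_mul_pi_mul_I, ← exp_add, ← exp_add, ← exp_add, ← exp_add]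
  congr 1
  field_simp
  ring

lemma theta2Null_eq (z : ℂ) :
    theta2Null z = exp (Real.pi * I * z / 2) * jacobiTheta₂ z (2 * z) := by
  rw [theta2Null, jacobiTheta₂, ← tsum_mul_left]
  refine tsum_congr fun n => ?_
  rw [qpow, jacobiTheta₂_term, ← exp_add]
  congr 1
  ring

lemma theta3Null_eq (z : ℂ) : theta3Null z = jacobiTheta₂ 0 (2 * z) := by
  refine tsum_congr fun n => ?_
  rw [qpow, jacobiTheta₂_term]
  congr 1
  ring

lemma theta4Null_eq (z : ℂ) : theta4Null z = jacobiTheta₂ (1 / 2) (2 * z) := by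
  refine tsum_congr fun n => ?_
  rw [qpow, jacobiTheta₂_term, ← exp_int_mul_pi_mul_I, ← exp_add]
  congr 1
  ring

/-! ### The combination of `nd` and `sd` as a theta quotient. -/

/-- The theta function of nome `q ^ (1 / 2)` whose quotient at `v` and `-v` is `nd + k sd`. -/
noncomputable def halfTheta (z v : ℂ) : ℂ := jacobiTheta₂ (v / (2 * Real.pi) - 1 / 4) z

lemma jacobiTheta₂_sub_half (u τ : ℂ) :
    jacobiTheta₂ (u - 1 / 2) τ = jacobiTheta₂ (u + 1 / 2) τ := by
  rw [← jacobiTheta₂_add_left (u - 1 / 2)]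
  congr 1
  ring

/-- The product formula with equal arguments. The quarter shift doubles to a half shift, which turns
`ϑ₃(v)` into `ϑ₄(v)` and produces the factor `exp (-iπ/2) = -i` of `ϑ₁`. -/
lemma halfTheta_sq {z : ℂ} (hz : 0 < z.im) (v : ℂ) :
    halfTheta z v ^ 2 = theta3Null z * theta4 z v + theta2Null z * theta1 z v := by
  have hpi : (Real.pi : ℂ) ≠ 0 := ofReal_ne_zero.mpr Real.pi_ne_zero
  rw [halfTheta, sq, jacobiTheta₂_mul _ _ hz, theta3Null_eq, theta4_eq, theta2Null_eq, theta1_eq]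
  have e1 : v / (2 * Real.pi) - 1 / 4 + (v / (2 * Real.pi) - 1 / 4) = v / Real.pi - 1 / 2 := by
    field_simp; ring
  have e2 : v / Real.pi - 1 / 2 + z = v / Real.pi + z - 1 / 2 := by ring
  rw [e1, e2, sub_self, zero_add, jacobiTheta₂_sub_half, jacobiTheta₂_sub_half]
  have e3 : exp (Real.pi * I * (2 * (v / (2 * Real.pi) - 1 / 4) + z)) =
      -I * (exp (Real.pi * I * z / 2) * exp (Real.pi * I * z / 2) * exp (I * v)) := by
    have : -I = exp (-(Real.pi / 2 * I)) := by
      rw [exp_neg, exp_pi_div_two_mul_I, inv_I]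
    rw [this, ← exp_add, ← exp_add, ← exp_add]
    congr 1
    field_simp
    ring
  rw [e3]
  ring

/-- Up to a period the argument is the half-period `(1 + τ)/2` with `τ = 2z`, where evenness and
quasi-periodicity together force the value to equal its own negative. -/
lemma jacobiTheta₂_sub_half_eq_zero (z : ℂ) : jacobiTheta₂ (z - 1 / 2) (2 * z) = 0 := by
  have h := jacobiTheta₂_add_left' (-1 / 2 - z) (2 * z)
  have e1 : -1 / 2 - z + 2 * z = z - 1 / 2 := by ring
  have e2 : -Real.pi * I * (2 * z + 2 * (-1 / 2 - z)) = Real.pi * I := by ring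
  have e3 : jacobiTheta₂ (-1 / 2 - z) (2 * z) = jacobiTheta₂ (z - 1 / 2) (2 * z) := by
    rw [← jacobiTheta₂_neg_left, jacobiTheta₂_sub_half]
    congr 1
    ring
  rw [e1, e2, e3, exp_pi_mul_I] at h
  linear_combination h / 2

/-- In the product formula the arguments sum to `-1/2`, so the second term contains the zero of
theta just found and drops out. -/
lemma halfTheta_mul_neg {z : ℂ} (hz : 0 < z.im) (v : ℂ) :
    halfTheta z v * halfTheta z (-v) = theta4Null z * theta3 z v := by
  have hpi : (Real.pi : ℂ) ≠ 0 := ofReal_ne_zero.mpr Real.pi_ne_zero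
  rw [halfTheta, halfTheta, jacobiTheta₂_mul _ _ hz, theta4Null_eq, theta3_eq]
  have e1 : v / (2 * Real.pi) - 1 / 4 + (-v / (2 * Real.pi) - 1 / 4) = 0 - 1 / 2 := by
    field_simp; ring
  have e2 : v / (2 * Real.pi) - 1 / 4 - (-v / (2 * Real.pi) - 1 / 4) = v / Real.pi := by
    field_simp; ring
  have e3 : 0 - 1 / 2 + z = z - 1 / 2 := by ring
  rw [e1, e2, e3, jacobiTheta₂_sub_half_eq_zero, jacobiTheta₂_sub_half, zero_add, zero_mul,
    mul_zero, add_zero]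

/-- Halving and rescaling `v` turns the strip `|Im v| < π Im z` into exactly the zero-free strip of
`jacobiTheta₂_ne_zero`. -/
lemma halfTheta_ne_zero {z v : ℂ} (hv : |v.im| < Real.pi * z.im) : halfTheta z v ≠ 0 := by
  refine jacobiTheta₂_ne_zero ?_
  have e : (v / (2 * Real.pi) - 1 / 4 : ℂ).im = v.im / (2 * Real.pi) := by
    have : (2 * Real.pi : ℂ) = ((2 * Real.pi : ℝ) : ℂ) := by push_cast; ring
    rw [this, sub_im, div_ofReal_im]
    norm_num
  have hpi := Real.pi_pos
  rw [e, abs_div, abs_of_pos (by positivity : 0 < 2 * Real.pi), div_lt_iff₀ (by positivity)]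
  linarith

lemma theta4Null_ne_zero {z : ℂ} (hz : 0 < z.im) : theta4Null z ≠ 0 := by
  have h0 : |(0 : ℂ).im| < Real.pi * z.im := by simpa using mul_pos Real.pi_pos hz
  have := halfTheta_mul_neg hz 0
  rw [neg_zero] at this
  exact left_ne_zero_of_mul (this ▸ mul_ne_zero (halfTheta_ne_zero h0) (halfTheta_ne_zero h0))

lemma theta3_ne_zero {z v : ℂ} (hz : 0 < z.im) (hv : |v.im| < Real.pi * z.im) :
    theta3 z v ≠ 0 := by
  have hv' : |(-v).im| < Real.pi * z.im := by rwa [neg_im, abs_neg]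
  exact right_ne_zero_of_mul
    (halfTheta_mul_neg hz v ▸ mul_ne_zero (halfTheta_ne_zero hv) (halfTheta_ne_zero hv'))

lemma theta3Null_ne_zero {z : ℂ} (hz : 0 < z.im) : theta3Null z ≠ 0 := by
  have h0 : |(0 : ℂ).im| < Real.pi * z.im := by simpa using mul_pos Real.pi_pos hz
  have := theta3_ne_zero hz h0
  rwa [theta3_eq, zero_div, ← theta3Null_eq] at this

/-- The combination `nd + k sd` as a quotient of theta functions of nome `q ^ (1 / 2)`. -/
theorem nd_add_modulus_mul_sd {z u : ℂ} (hz : 0 < z.im)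
    (hu : |(Real.pi * u / (2 * ellK z)).im| < Real.pi * z.im) :
    nd z u + modulus z * sd z u =
      halfTheta z (Real.pi * u / (2 * ellK z)) / halfTheta z (-(Real.pi * u / (2 * ellK z))) := by
  rw [nd, sd, modulus]
  set v := Real.pi * u / (2 * ellK z)
  have hv' : |(-v).im| < Real.pi * z.im := by rwa [neg_im, abs_neg]
  have h3 := theta3Null_ne_zero hz
  have h4 := theta4Null_ne_zero hz
  have h3v := theta3_ne_zero hz hu
  have hp := halfTheta_ne_zero hu
  have hm := halfTheta_ne_zero hv'
  have key : halfTheta z v / halfTheta z (-v) =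
      (theta3Null z * theta4 z v + theta2Null z * theta1 z v) / (theta4Null z * theta3 z v) := by
    rw [← halfTheta_sq hz, ← halfTheta_mul_neg hz]
    field_simp
  rw [key]
  -- No nonvanishing of `ϑ₂` is needed: if it were zero, `modulus` would be zero and the term `ϑ₂
  -- ϑ₁(v)` in the numerator would vanish as well.
  rcases eq_or_ne (theta2Null z) 0 with h2 | h2
  · rw [h2]
    field_simp
  · field_simp

lemma exp_two_pi_mul_I_quarter (v : ℂ) :
    exp (2 * Real.pi * I * (v / (2 * Real.pi) - 1 / 4)) = -(I * exp (I * v)) := by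
  have hpi : (Real.pi : ℂ) ≠ 0 := ofReal_ne_zero.mpr Real.pi_ne_zero
  have : -I = exp (-(Real.pi / 2 * I)) := by
    rw [exp_neg, exp_pi_div_two_mul_I, inv_I]
  rw [← neg_mul, this, ← exp_add]
  congr 1
  field_simp
  ring

lemma inv_exp_two_pi_mul_I_quarter (v : ℂ) :
    (exp (2 * Real.pi * I * (v / (2 * Real.pi) - 1 / 4)))⁻¹ = I * exp (I * -v) := by
  rw [exp_two_pi_mul_I_quarter, inv_neg, mul_inv, inv_I, mul_neg, exp_neg]
  ring

/-- The quotient of theta functions is the exponential of a sum of inverse hyperbolic tangents. -/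
theorem halfTheta_div_neg {z v : ℂ} (hz : 0 < z.im) (hv : |v.im| < Real.pi * z.im) :
    halfTheta z v / halfTheta z (-v) = exp (2 * (arctanhSum z (-v) - arctanhSum z v)) := by
  have hv' : |(-v).im| < Real.pi * z.im := by rwa [neg_im, abs_neg]
  obtain ⟨c, hc, h⟩ := exists_tendsto_triple_product hz
  have hp := h (v / (2 * Real.pi) - 1 / 4)
  have hm := h (-v / (2 * Real.pi) - 1 / 4)
  rw [inv_exp_two_pi_mul_I_quarter, exp_two_pi_mul_I_quarter] at hp hm
  rw [neg_neg] at hm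
  have hm0 := halfTheta_ne_zero hv'
  have hdiv := hp.div hm (mul_ne_zero hc hm0)
  -- The constant of the triple product does not depend on the argument and cancels, so its value is
  -- never needed.
  rw [mul_div_mul_left _ _ hc] at hdiv
  have hsum := ((summable_arctanh_nomeArg hz hv' le_rfl).hasSum.sub
    (summable_arctanh_nomeArg hz hv le_rfl).hasSum).mul_left 2 |>.tendsto_sum_nat
  refine tendsto_nhds_unique hdiv (((continuous_exp.tendsto _).comp hsum).congr fun N => ?_)
  rw [Function.comp_apply, exp_sum]
  simp only [Pi.div_apply]
  rw [← prod_div_distrib]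
  refine prod_congr rfl fun k _ => ?_
  have hX := (norm_nomeArg_le' hz (v := v) le_rfl k).trans_lt (exp_sub_lt_one hv)
  have hY := (norm_nomeArg_le' hz (v := -v) le_rfl k).trans_lt (exp_sub_lt_one hv')
  rw [mul_sub, exp_sub, exp_two_mul_arctanh hX, exp_two_mul_arctanh hY]
  have eX : ∀ v : ℂ, nomeArg z v k = exp (Real.pi * I * z) ^ (2 * k + 1) * (I * exp (I * v)) :=
    fun v => by rw [nomeArg_eq]; ring
  simp only [mul_neg, ← eX, ← sub_eq_add_neg]
  simp only [← mul_neg, ← eX]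
  rw [div_div_div_eq]
  ring

/-! ### The branch of the logarithm and the modular angle. -/

lemma ellK_ne_zero {z : ℂ} (hz : 0 < z.im) : ellK z ≠ 0 :=
  mul_ne_zero (div_ne_zero (ofReal_ne_zero.mpr Real.pi_ne_zero) two_ne_zero)
    (pow_ne_zero _ (theta3Null_ne_zero hz))

/-- The branch of `log (nd + k sd)` continued from `0` along a segment in the strip where the theta
quotient has neither zeros nor poles. -/
theorem isLogFromZero_nd_add_modulus_mul_sd {z u v : ℂ} (hz : 0 < z.im)
    (huv : Real.pi * u / (2 * ellK z) = v) (hv : |v.im| < Real.pi * z.im) :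
    IsLogFromZero (fun u => nd z u + modulus z * sd z u) u
      (2 * (arctanhSum z (-v) - arctanhSum z v)) := by
  have him : ∀ t ∈ Set.Icc (0 : ℝ) 1, |((t : ℂ) * v).im| ≤ |v.im| := fun t ht => by
    rw [im_ofReal_mul, abs_mul, abs_of_nonneg ht.1]
    exact mul_le_of_le_one_left (abs_nonneg _) ht.2
  refine ⟨fun t => 2 * (arctanhSum z (-(t * v)) - arctanhSum z (t * v)), ?_, ?_, ?_, ?_⟩
  · have hc := continuousOn_arctanhSum hz hv
    have h1 : ContinuousOn (fun t : ℝ => arctanhSum z (t * v)) (Set.Icc 0 1) :=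
      hc.comp (f := fun t : ℝ => (t : ℂ) * v) (by fun_prop) him
    have h2 : ContinuousOn (fun t : ℝ => arctanhSum z (-(t * v))) (Set.Icc 0 1) :=
      hc.comp (f := fun t : ℝ => -((t : ℂ) * v)) (by fun_prop) fun t ht => by
        change |(-((t : ℂ) * v)).im| ≤ |v.im|
        rw [neg_im, abs_neg]
        exact him t ht
    exact continuousOn_const.mul (h2.sub h1)
  · simp
  · simp
  · intro t ht
    have e : Real.pi * (t * u) / (2 * ellK z) = t * v := by rw [← huv]; ring
    have ht' : |((t : ℂ) * v).im| < Real.pi * z.im := (him t ht).trans_lt hv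
    change exp (2 * (arctanhSum z (-(t * v)) - arctanhSum z (t * v))) =
      nd z (t * u) + modulus z * sd z (t * u)
    rw [nd_add_modulus_mul_sd hz (by rwa [e]), e, halfTheta_div_neg hz ht']

/-- At the argument attached to `a`, the terms of `arctanhSum` are those of the modular angle. -/
lemma nomeArg_eq_qpow (z : ℂ) (a : ℝ) (k : ℕ) :
    nomeArg z (Real.pi / 2 * (-1 + (4 * a - 2) * z)) k = qpow z ((k : ℂ) + a) := by
  have hI : I = exp (Real.pi / 2 * I) := exp_pi_div_two_mul_I.symm
  rw [nomeArg, qpow, qpow]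
  nth_rewrite 1 [hI]
  rw [← exp_add, ← exp_add]
  congr 1
  ring_nf

lemma hasSum_lambert_of_modularAngle {z v : ℂ} (hz : 0 < z.im) (hv : |v.im| < Real.pi * z.im)
    {a : ℝ} (hva : v = Real.pi / 2 * (-1 + (4 * a - 2) * z)) :
    Summable (fun n : ℕ => arctanh (qpow z ((n : ℂ) + a))) ∧
    HasSum (fun n : ℕ => (-1 : ℂ) ^ n * qpow z ((n : ℂ) + 1 / 2) /
        ((2 * (n : ℂ) + 1) * (1 - qpow z (2 * (n : ℂ) + 1))) * cos ((2 * (n : ℂ) + 1) * v))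
      (1 / (2 * I) * modularAngle z a +
        1 / (4 * I) * (2 * (arctanhSum z (-v) - arctanhSum z v))) := by
  have harg : ∀ k, nomeArg z v k = qpow z ((k : ℂ) + a) := fun k => hva ▸ nomeArg_eq_qpow z a k
  have hang : modularAngle z a = 2 * arctanhSum z v := by
    simp only [modularAngle, arctanhSum, harg]
  refine ⟨?_, ?_⟩
  · simpa only [harg] using summable_arctanh_nomeArg hz hv (v := v) le_rfl
  -- With `A = arctanhSum z`, the two sides agree because `2A(v)/(2i) + 2(A(-v) - A(v))/(4i) = (A(v)
  -- + A(-v))/(2i)`.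
  · convert! hasSum_lambert hz hv using 1
    rw [hang]
    have := I_ne_zero
    field_simp
    ring

/-! ### The hypergeometric function and Gauss's quadratic transformation -/

/-- The coefficients `(1/2)_n / n!` of the power series of `(1 - w) ^ (-1/2)`. -/
noncomputable def halfCoeff (n : ℕ) : ℝ := ∏ i ∈ range n, ((2 * i + 1 : ℝ) / (2 * i + 2))

lemma halfCoeff_nonneg (n : ℕ) : 0 ≤ halfCoeff n := prod_nonneg fun i _ => by positivity

lemma halfCoeff_le_one (n : ℕ) : halfCoeff n ≤ 1 :=
  prod_le_one (fun i _ => by positivity) fun i _ => by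
    rw [div_le_one (by positivity)]; linarith

lemma ascPochhammer_eval_half (n : ℕ) :
    (ascPochhammer ℝ n).eval (1 / 2) = halfCoeff n * n.factorial := by
  induction n with
  | zero => simp [halfCoeff]
  | succ n ih =>
    rw [ascPochhammer_succ_eval, ih, halfCoeff, halfCoeff, prod_range_succ, Nat.factorial_succ]
    push_cast
    field_simp
    ring

lemma multichoose_half (n : ℕ) : Ring.multichoose (1 / 2 : ℂ) n = halfCoeff n := by
  have h := Ring.factorial_nsmul_multichoose_eq_ascPochhammer (1 / 2 : ℝ) n
  rw [Polynomial.ascPochhammer_smeval_eq_eval, ascPochhammer_eval_half, nsmul_eq_mul,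
    mul_comm] at h
  have h' := mul_right_cancel₀ (Nat.cast_ne_zero.mpr n.factorial_ne_zero) h
  rw [← h']
  have := Ring.map_multichoose (algebraMap ℝ ℂ) (1 / 2 : ℝ) n
  simpa using this.symm

/-- The power series of `(1 - w) ^ (-1/2)`. -/
noncomputable def invSqrt (w : ℂ) : ℂ := ∑' n, (halfCoeff n : ℂ) * w ^ n

lemma summable_norm_halfCoeff_mul_pow {w : ℂ} (hw : ‖w‖ < 1) :
    Summable fun n => ‖(halfCoeff n : ℂ) * w ^ n‖ := by
  refine (summable_geometric_of_lt_one (norm_nonneg w) hw).of_nonneg_of_le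
    (fun _ => norm_nonneg _) fun n => ?_
  rw [norm_mul, norm_pow, norm_real, Real.norm_of_nonneg (halfCoeff_nonneg n)]
  exact mul_le_of_le_one_left (by positivity) (halfCoeff_le_one n)

/-- The coefficients are those of the binomial series of `(1 - w)^(-1/2)`; squaring removes the
choice of root. -/
lemma invSqrt_sq {w : ℂ} (hw : ‖w‖ < 1) : invSqrt w ^ 2 = (1 - w)⁻¹ := by
  have hmem : w ∈ Metric.eball (0 : ℂ) 1 := by
    rw [← ENNReal.ofReal_one, Metric.eball_ofReal]
    simpa using hw
  have h := (one_div_one_sub_cpow_hasFPowerSeriesOnBall_zero (1 / 2)).hasSum hmem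
  have e : invSqrt w = 1 / (1 - w) ^ (1 / 2 : ℂ) := by
    rw [invSqrt, ← zero_add w, ← h.tsum_eq, zero_add]
    refine tsum_congr fun n => ?_
    rw [FormalMultilinearSeries.ofScalars_apply_eq, ← Ring.multichoose_eq, multichoose_half,
      smul_eq_mul]
  rw [e, div_pow, one_pow, ← cpow_nat_mul]
  norm_num

lemma norm_invSqrt_sq {w : ℂ} (hw : ‖w‖ < 1) : ‖invSqrt w‖ ^ 2 = ‖1 - w‖⁻¹ := by
  rw [← norm_pow, invSqrt_sq hw, norm_inv]

lemma hasSum_inv_sqrt {x : ℝ} (h0 : 0 ≤ x) (h1 : x < 1) :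
    HasSum (fun n => halfCoeff n * x ^ n) (√(1 - x))⁻¹ := by
  have hx : ‖(x : ℂ)‖ < 1 := by rwa [norm_real, Real.norm_of_nonneg h0]
  have hs : Summable fun n => halfCoeff n * x ^ n := by
    rw [← summable_ofReal]
    simpa using (summable_norm_halfCoeff_mul_pow hx).of_norm
  have hsq : (∑' n, halfCoeff n * x ^ n) ^ 2 = (1 - x)⁻¹ := by
    have := invSqrt_sq hx
    rw [invSqrt] at this
    exact_mod_cast this
  have h0' : 0 ≤ ∑' n, halfCoeff n * x ^ n :=
    tsum_nonneg fun n => mul_nonneg (halfCoeff_nonneg n) (by positivity)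
  -- Nonnegativity of the series selects the positive square root.
  rw [← Real.sqrt_inv, ← hsq, Real.sqrt_sq h0']
  exact hs.hasSum

/-- The power series `∑ ((1/2)_n / n!) ^ 2 x ^ n`. -/
noncomputable def ellF (x : ℝ) : ℝ := ∑' n, halfCoeff n ^ 2 * x ^ n

lemma ordinaryHypergeometric_half_half_one (x : ℝ) :
    ordinaryHypergeometric (1 / 2 : ℝ) (1 / 2 : ℝ) (1 : ℝ) x = ellF x := by
  rw [ordinaryHypergeometric_eq_tsum, ellF]
  refine tsum_congr fun n => ?_
  have := n.factorial_ne_zero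
  rw [ascPochhammer_eval_half, ascPochhammer_eval_one, smul_eq_mul]
  field_simp

lemma integral_exp_int_mul_two {k : ℤ} (hk : k ≠ 0) :
    ∫ x in (0 : ℝ)..Real.pi, exp (2 * k * I * x) = 0 := by
  have hc : (2 * k * I : ℂ) ≠ 0 :=
    mul_ne_zero (mul_ne_zero two_ne_zero (Int.cast_ne_zero.mpr hk)) I_ne_zero
  rw [integral_exp_mul_complex hc]
  have e : (2 * k * I * (Real.pi : ℝ) : ℂ) = k * (2 * Real.pi * I) := by ring
  rw [e, exp_int_mul_two_pi_mul_I]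
  simp

/-- The mean of `|1 + t e ^ (2 i x)|⁻¹`, by Parseval's identity. -/
theorem integral_inv_norm_eq {t : ℝ} (h0 : 0 ≤ t) (h1 : t < 1) :
    ∫ x in (0 : ℝ)..Real.pi, ‖1 + t * exp (2 * I * x)‖⁻¹ = Real.pi * ellF (t ^ 2) := by
  have hexp : ∀ x : ℝ, ‖exp (2 * I * x)‖ = 1 := fun x => by
    have : 2 * I * x = ((2 * x : ℝ) : ℂ) * I := by push_cast; ring
    rw [this, norm_exp_ofReal_mul_I]
  have hw : ∀ x : ℝ, ‖-(t * exp (2 * I * x))‖ = t := fun x => by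
    rw [norm_neg, norm_mul, hexp, mul_one, norm_real, Real.norm_of_nonneg h0]
  have hconj : ∀ x : ℝ, (starRingEnd ℂ) (-(t * exp (2 * I * x))) = -(t * exp (-(2 * I * x))) := by
    intro x
    rw [map_neg, map_mul, conj_ofReal, ← exp_conj, map_mul, map_mul, conj_I, conj_ofReal,
      map_ofNat, mul_neg, neg_mul]
  set F : ℕ × ℕ → ℝ → ℂ := fun p x =>
    (halfCoeff p.1 * (-(t * exp (2 * I * x))) ^ p.1) *
      (halfCoeff p.2 * (-(t * exp (-(2 * I * x)))) ^ p.2) with hF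
  have hbound : Summable fun p : ℕ × ℕ => t ^ p.1 * t ^ p.2 :=
    (summable_geometric_of_lt_one h0 h1).mul_of_nonneg (summable_geometric_of_lt_one h0 h1)
      (fun _ => by positivity) fun _ => by positivity
  have hnorm : ∀ p x, ‖F p x‖ ≤ t ^ p.1 * t ^ p.2 := fun p x => by
    have h2 : ‖-(t * exp (-(2 * I * x)))‖ = t := by rw [← hconj, norm_conj, hw]
    simp only [hF, norm_mul, norm_pow, hw, h2, norm_real,
      Real.norm_of_nonneg (halfCoeff_nonneg _)]
    gcongr
    · exact mul_nonneg (halfCoeff_nonneg _) (by positivity)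
    · exact mul_le_of_le_one_left (by positivity) (halfCoeff_le_one _)
    · exact mul_le_of_le_one_left (by positivity) (halfCoeff_le_one _)
  have hpt : ∀ x : ℝ, HasSum (fun p => F p x) ((‖1 + t * exp (2 * I * x)‖⁻¹ : ℝ) : ℂ) := by
    intro x
    have hlt : ‖-(t * exp (2 * I * x))‖ < 1 := by rwa [hw]
    have hs := summable_norm_halfCoeff_mul_pow hlt
    have hs' : Summable fun n => ‖(halfCoeff n : ℂ) * (-(t * exp (-(2 * I * x)))) ^ n‖ := by
      rw [← hconj]
      exact summable_norm_halfCoeff_mul_pow (by rwa [norm_conj])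
    have hprod := (summable_mul_of_summable_norm hs hs').hasSum
    rw [← tsum_mul_tsum_of_summable_norm hs hs'] at hprod
    -- With `f = invSqrt` and `w = -t e^(2ix)`, the integrand is `|f(w)|^2 = f(w) conj (f(w))`, a
    -- product of two power series.
    have e : ((‖1 + t * exp (2 * I * x)‖⁻¹ : ℝ) : ℂ) =
        (∑' n, (halfCoeff n : ℂ) * (-(t * exp (2 * I * x))) ^ n) *
          ∑' n, (halfCoeff n : ℂ) * (-(t * exp (-(2 * I * x)))) ^ n := by
      have h := norm_invSqrt_sq hlt
      rw [sub_neg_eq_add] at h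
      rw [← h, ofReal_pow, ← mul_conj', invSqrt, conj_tsum]
      congr 2
      funext n
      rw [map_mul, map_pow, conj_ofReal, hconj]
    rw [e]
    exact hprod
  have hint := intervalIntegral.hasSum_integral_of_dominated_convergence
    (μ := MeasureTheory.volume) (a := 0) (b := Real.pi) (F := F)
    (fun p _ => t ^ p.1 * t ^ p.2)
    (fun p => by
      have : Continuous (F p) := by simp only [hF]; fun_prop
      exact this.aestronglyMeasurable)
    (fun p => Eventually.of_forall fun x _ => hnorm p x)
    (Eventually.of_forall fun x _ => hbound)
    (by simp)
    (Eventually.of_forall fun x _ => hpt x)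
  have hval : ∀ p : ℕ × ℕ, ∫ x in (0 : ℝ)..Real.pi, F p x =
      if p.1 = p.2 then ((Real.pi * (halfCoeff p.1 ^ 2 * (t ^ 2) ^ p.1) : ℝ) : ℂ) else 0 := by
    intro p
    have hFp : ∀ x : ℝ, F p x = (halfCoeff p.1 * halfCoeff p.2 * (-t) ^ p.1 * (-t) ^ p.2 : ℂ) *
        exp (2 * ((p.1 : ℤ) - (p.2 : ℤ) : ℤ) * I * x) := by
      intro x
      have e : exp (2 * ((p.1 : ℤ) - (p.2 : ℤ) : ℤ) * I * x) =
          exp (2 * I * x) ^ p.1 * exp (-(2 * I * x)) ^ p.2 := by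
        rw [← exp_nat_mul, ← exp_nat_mul, ← exp_add]
        congr 1
        push_cast
        ring
      simp only [hF]
      rw [e, ← neg_mul, ← neg_mul, mul_pow, mul_pow]
      ring
    simp_rw [hFp]
    rw [intervalIntegral.integral_const_mul]
    split_ifs with h
    · have e : (-(t : ℂ)) ^ p.2 * (-(t : ℂ)) ^ p.2 = ((t : ℂ) ^ 2) ^ p.2 := by
        rw [← mul_pow, neg_mul_neg, sq]
      rw [h, sub_self, mul_assoc (_ * _) ((-(t : ℂ)) ^ p.2) ((-(t : ℂ)) ^ p.2), e]
      simp
      ring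
    · rw [integral_exp_int_mul_two (by omega), mul_zero]
  simp_rw [hval] at hint
  -- Orthogonality of the exponentials leaves only the diagonal of the double series.
  have hinj : Function.Injective fun n : ℕ => (n, n) := fun a b h => (Prod.mk.inj h).1
  rw [← hinj.hasSum_iff] at hint
  · simp only [Function.comp_def, if_true] at hint
    have := hint.tsum_eq
    rw [intervalIntegral.integral_ofReal, ← ofReal_tsum, tsum_mul_left] at this
    exact (ofReal_injective this).symm
  · rintro ⟨m, n⟩ hmn
    refine if_neg fun h => hmn ⟨m, ?_⟩
    simp only at h
    rw [h]

/-- The mean of `|1 + t e ^ (2 i x)|⁻¹`, by the power series in `sin x ^ 2`. -/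
theorem integral_inv_norm_eq' {t : ℝ} (h0 : 0 ≤ t) (h1 : t < 1) :
    ∫ x in (0 : ℝ)..Real.pi, ‖1 + t * exp (2 * I * x)‖⁻¹ =
      Real.pi * (ellF (4 * t / (1 + t) ^ 2) / (1 + t)) := by
  set s := 4 * t / (1 + t) ^ 2 with hs
  have hs0 : 0 ≤ s := by positivity
  have hs1 : s < 1 := by
    rw [hs, div_lt_one (by positivity)]
    have : 0 < (1 - t) ^ 2 := by have : 0 < 1 - t := by linarith
                                 positivity
    nlinarith
  have hsin : ∀ x : ℝ, 0 ≤ s * Real.sin x ^ 2 ∧ s * Real.sin x ^ 2 ≤ s := fun x =>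
    ⟨by positivity, mul_le_of_le_one_right hs0 (Real.sin_sq_le_one x)⟩
  -- Here `|1 + t e^(2ix)|^2 = 1 + 2t cos 2x + t^2 = (1 + t)^2 - 4t sin^2 x`, which explains the
  -- choice of `s`.
  have hnorm : ∀ x : ℝ, ‖1 + t * exp (2 * I * x)‖ = (1 + t) * √(1 - s * Real.sin x ^ 2) := by
    intro x
    have e : exp (2 * I * x) = (Real.cos (2 * x) : ℂ) + (Real.sin (2 * x) : ℂ) * I := by
      rw [ofReal_cos, ofReal_sin, ← exp_mul_I]
      congr 1
      push_cast
      ring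
    have h : ‖1 + t * exp (2 * I * x)‖ ^ 2 = (1 + t) ^ 2 * (1 - s * Real.sin x ^ 2) := by
      rw [e, ← normSq_eq_norm_sq, normSq_apply]
      have hst : (1 + t) ^ 2 * s = 4 * t := by rw [hs]; field_simp
      simp only [add_re, one_re, mul_re, ofReal_re, ofReal_im, I_re, I_im, add_im, one_im, mul_im]
      have h2 := Real.sin_sq_add_cos_sq (2 * x)
      have h3 := Real.cos_two_mul x
      have h4 := Real.sin_sq_add_cos_sq x
      linear_combination t ^ 2 * h2 + 2 * t * h3 + 4 * t * h4 + Real.sin x ^ 2 * hst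
    rw [← Real.sqrt_sq (norm_nonneg _), h, Real.sqrt_mul (by positivity),
      Real.sqrt_sq (by positivity)]
  have hint := intervalIntegral.hasSum_integral_of_dominated_convergence
    (μ := MeasureTheory.volume) (a := 0) (b := Real.pi)
    (F := fun n x => halfCoeff n * (s * Real.sin x ^ 2) ^ n)
    (f := fun x => (√(1 - s * Real.sin x ^ 2))⁻¹)
    (fun n _ => s ^ n)
    (fun n => Continuous.aestronglyMeasurable (by fun_prop))
    (fun n => Eventually.of_forall fun x _ => by
      rw [Real.norm_of_nonneg (mul_nonneg (halfCoeff_nonneg n) (pow_nonneg (hsin x).1 n))]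
      exact (mul_le_of_le_one_left (pow_nonneg (hsin x).1 n) (halfCoeff_le_one n)).trans
        (pow_le_pow_left₀ (hsin x).1 (hsin x).2 n))
    (Eventually.of_forall fun x _ => summable_geometric_of_lt_one hs0 hs1)
    (by simp)
    (Eventually.of_forall fun x _ => hasSum_inv_sqrt (hsin x).1 ((hsin x).2.trans_lt hs1))
  have hval : ∀ n : ℕ, ∫ x in (0 : ℝ)..Real.pi, halfCoeff n * (s * Real.sin x ^ 2) ^ n =
      Real.pi * (halfCoeff n ^ 2 * s ^ n) := by
    intro n
    simp_rw [mul_pow, ← pow_mul, ← mul_assoc]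
    -- The Wallis product for the integral of `sin^(2n)` is again `halfCoeff n`, whence the square.
    rw [intervalIntegral.integral_const_mul, integral_sin_pow_even, ← halfCoeff]
    ring
  simp_rw [hval] at hint
  have hF := hint.tsum_eq
  rw [tsum_mul_left] at hF
  simp_rw [hnorm, mul_inv]
  rw [intervalIntegral.integral_const_mul, ← hF, ← ellF]
  ring

/-- Gauss's quadratic transformation. -/
theorem ellF_quadratic {t : ℝ} (h0 : 0 ≤ t) (h1 : t < 1) :
    ellF (4 * t / (1 + t) ^ 2) = (1 + t) * ellF (t ^ 2) := by
  have h := (integral_inv_norm_eq h0 h1).symm.trans (integral_inv_norm_eq' h0 h1)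
  have h' := mul_left_cancel₀ Real.pi_ne_zero h
  rw [h']
  field_simp

lemma ellF_zero : ellF 0 = 1 := by
  rw [← ordinaryHypergeometric_half_half_one, ordinaryHypergeometric_zero]

lemma continuousAt_ellF_zero : ContinuousAt ellF 0 := by
  have h : ContinuousOn ellF (Metric.closedBall 0 (1 / 2)) := by
    refine continuousOn_tsum (fun n => by fun_prop)
      (summable_geometric_of_lt_one (r := 1 / 2) (by norm_num) (by norm_num)) fun n x hx => ?_
    have hx' : ‖x‖ ≤ 1 / 2 := by simpa using hx
    rw [norm_mul, norm_pow, norm_pow, Real.norm_of_nonneg (halfCoeff_nonneg n)]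
    calc halfCoeff n ^ 2 * ‖x‖ ^ n ≤ 1 * (1 / 2) ^ n := by
          gcongr
          exact pow_le_one₀ (halfCoeff_nonneg n) (halfCoeff_le_one n)
      _ = (1 / 2) ^ n := one_mul _
  exact h.continuousAt (Metric.closedBall_mem_nhds _ (by norm_num))

lemma ellF_pos {x : ℝ} (h0 : 0 ≤ x) (h1 : x < 1) : 0 < ellF x := by
  have hs : Summable fun n => halfCoeff n ^ 2 * x ^ n := by
    refine (summable_geometric_of_lt_one h0 h1).of_nonneg_of_le
      (fun n => by positivity) fun n => ?_
    exact mul_le_of_le_one_left (by positivity)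
      (pow_le_one₀ (halfCoeff_nonneg n) (halfCoeff_le_one n))
  refine hs.tsum_pos (fun n => by positivity) 0 ?_
  simp [halfCoeff]

/-! ### Theta constants on the imaginary axis -/

lemma theta3Null_sq {z : ℂ} (hz : 0 < z.im) :
    theta3Null z ^ 2 = theta3Null (2 * z) ^ 2 + theta2Null (2 * z) ^ 2 := by
  have h2 : 0 < (2 * z).im := by simpa using hz
  have e : exp (Real.pi * I * (2 * z)) =
      exp (Real.pi * I * (2 * z) / 2) * exp (Real.pi * I * (2 * z) / 2) := by
    rw [← exp_add]; congr 1; ring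
  simp only [theta3Null_eq, theta2Null_eq]
  rw [sq, jacobiTheta₂_mul 0 0 h2]
  simp only [add_zero, sub_zero, mul_zero, zero_add]
  rw [e]
  ring

lemma theta4Null_sq {z : ℂ} (hz : 0 < z.im) :
    theta4Null z ^ 2 = theta3Null (2 * z) ^ 2 - theta2Null (2 * z) ^ 2 := by
  have h2 : 0 < (2 * z).im := by simpa using hz
  have e : exp (Real.pi * I * (2 * (1 / 2) + 2 * z)) =
      -(exp (Real.pi * I * (2 * z) / 2) * exp (Real.pi * I * (2 * z) / 2)) := by
    rw [← exp_add, ← neg_one_mul, ← exp_pi_mul_I, ← exp_add]; congr 1; ring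
  have e1 : (1 / 2 + 1 / 2 : ℂ) = 0 + 1 := by norm_num
  have e2 : 0 + 1 + 2 * z = 2 * z + 1 := by ring
  simp only [theta4Null_eq, theta3Null_eq, theta2Null_eq]
  rw [sq, jacobiTheta₂_mul (1 / 2) (1 / 2) h2, e, e1, e2, jacobiTheta₂_add_left,
    jacobiTheta₂_add_left, sub_self, zero_add]
  ring

/-- Quasi-periodicity makes the two terms of the product formula equal, hence the factor `2`. -/
lemma theta2Null_sq {z : ℂ} (hz : 0 < z.im) :
    theta2Null z ^ 2 = 2 * theta2Null (2 * z) * theta3Null (2 * z) := by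
  have h2 : 0 < (2 * z).im := by simpa using hz
  have e := jacobiTheta₂_add_left' 0 (2 * (2 * z))
  rw [zero_add] at e
  have e1 : z + z = 2 * z := by ring
  have e2 : 2 * z + 2 * z = 2 * (2 * z) := by ring
  simp only [theta2Null_eq, theta3Null_eq]
  rw [mul_pow, sq (jacobiTheta₂ z (2 * z)), jacobiTheta₂_mul z z h2, e1, e2, e, sub_self,
    zero_add, mul_zero, add_zero, ← mul_assoc (exp _) (exp _ * _), ← mul_assoc (exp _) (exp _),
    ← exp_add]
  have e3 : Real.pi * I * (2 * (2 * z)) + -Real.pi * I * (2 * (2 * z)) = 0 := by ring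
  have e4 : exp (Real.pi * I * z / 2) ^ 2 = exp (Real.pi * I * (2 * z) / 2) := by
    rw [← exp_nat_mul]; congr 1; push_cast; ring
  rw [e3, exp_zero, e4]
  ring

/-- The theta constant `ϑ₂` for nome `exp (-2 π t)`. -/
noncomputable def realTheta2 (t : ℝ) : ℝ :=
  ∑' n : ℤ, Real.exp (-(2 * Real.pi * ((n : ℝ) + 1 / 2) ^ 2 * t))

/-- The theta constant `ϑ₃` for nome `exp (-2 π t)`. -/
noncomputable def realTheta3 (t : ℝ) : ℝ := ∑' n : ℤ, Real.exp (-(2 * Real.pi * (n : ℝ) ^ 2 * t))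

/-- The theta constant `ϑ₄` for nome `exp (-2 π t)`. -/
noncomputable def realTheta4 (t : ℝ) : ℝ :=
  ∑' n : ℤ, (-1 : ℝ) ^ n * Real.exp (-(2 * Real.pi * (n : ℝ) ^ 2 * t))

lemma qpow_mul_I (t s : ℝ) : qpow (t * I) s = (Real.exp (-(2 * Real.pi * s * t)) : ℝ) := by
  rw [qpow, ofReal_exp]
  congr 1
  push_cast
  linear_combination (2 * Real.pi * s * t : ℂ) * I_sq

lemma theta2Null_mul_I (t : ℝ) : theta2Null (t * I) = realTheta2 t := by
  rw [theta2Null, realTheta2, ofReal_tsum]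
  refine tsum_congr fun n => ?_
  rw [← qpow_mul_I]
  push_cast
  rfl

lemma theta3Null_mul_I (t : ℝ) : theta3Null (t * I) = realTheta3 t := by
  rw [theta3Null, realTheta3, ofReal_tsum]
  refine tsum_congr fun n => ?_
  rw [← qpow_mul_I]
  push_cast
  rfl

lemma theta4Null_mul_I (t : ℝ) : theta4Null (t * I) = realTheta4 t := by
  rw [theta4Null, realTheta4, ofReal_tsum]
  refine tsum_congr fun n => ?_
  rw [ofReal_mul, ← qpow_mul_I]
  push_cast
  rfl

section

variable {t : ℝ}

lemma im_ofReal_mul_I_pos (ht : 0 < t) : 0 < ((t : ℂ) * I).im := by simpa using ht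

lemma realTheta2_pos (ht : 0 < t) : 0 < realTheta2 t := by
  have h2 : 0 < (2 * ((t : ℂ) * I)).im := by simpa using ht
  have hs : Summable fun n : ℤ => Real.exp (-(2 * Real.pi * ((n : ℝ) + 1 / 2) ^ 2 * t)) := by
    rw [← summable_ofReal]
    refine (((summable_jacobiTheta₂_term_iff (t * I) (2 * (t * I))).mpr h2).mul_left
      (exp (Real.pi * I * (t * I) / 2))).congr fun n => ?_
    have := qpow_mul_I t (((n : ℝ) + 1 / 2) ^ 2)
    rw [← this, qpow, jacobiTheta₂_term, ← exp_add]
    congr 1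
    push_cast
    ring
  exact hs.tsum_pos (fun n => (Real.exp_pos _).le) 0 (Real.exp_pos _)

lemma realTheta3_pos (ht : 0 < t) : 0 < realTheta3 t := by
  have h0 : realTheta3 t ≠ 0 := by
    have := theta3Null_ne_zero (im_ofReal_mul_I_pos ht)
    rwa [theta3Null_mul_I, ofReal_ne_zero] at this
  exact lt_of_le_of_ne (tsum_nonneg fun n => (Real.exp_pos _).le) h0.symm

lemma realTheta4_ne_zero (ht : 0 < t) : realTheta4 t ≠ 0 := by
  have := theta4Null_ne_zero (im_ofReal_mul_I_pos ht)
  rwa [theta4Null_mul_I, ofReal_ne_zero] at this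

lemma two_mul_ofReal_mul_I (t : ℝ) : 2 * ((t : ℂ) * I) = ((2 * t : ℝ) : ℂ) * I := by
  push_cast; ring

lemma realTheta3_sq (ht : 0 < t) :
    realTheta3 t ^ 2 = realTheta3 (2 * t) ^ 2 + realTheta2 (2 * t) ^ 2 := by
  have := theta3Null_sq (im_ofReal_mul_I_pos ht)
  rw [two_mul_ofReal_mul_I, theta3Null_mul_I, theta3Null_mul_I, theta2Null_mul_I] at this
  exact_mod_cast this

lemma realTheta4_sq (ht : 0 < t) :
    realTheta4 t ^ 2 = realTheta3 (2 * t) ^ 2 - realTheta2 (2 * t) ^ 2 := by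
  have := theta4Null_sq (im_ofReal_mul_I_pos ht)
  rw [two_mul_ofReal_mul_I, theta4Null_mul_I, theta3Null_mul_I, theta2Null_mul_I] at this
  exact_mod_cast this

lemma realTheta2_sq (ht : 0 < t) :
    realTheta2 t ^ 2 = 2 * realTheta2 (2 * t) * realTheta3 (2 * t) := by
  have := theta2Null_sq (im_ofReal_mul_I_pos ht)
  rw [two_mul_ofReal_mul_I, theta2Null_mul_I, theta3Null_mul_I, theta2Null_mul_I] at this
  exact_mod_cast this

/-- The modulus for nome `exp (-2 π t)`. -/
noncomputable def realModulus (t : ℝ) : ℝ := realTheta2 t ^ 2 / realTheta3 t ^ 2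

lemma realModulus_pos (ht : 0 < t) : 0 < realModulus t :=
  div_pos (pow_pos (realTheta2_pos ht) 2) (pow_pos (realTheta3_pos ht) 2)

/-- The difference `ϑ₃^2 - ϑ₂^2` is the square of the real nonzero number `ϑ₄` at `t/2`. -/
lemma realModulus_lt_one (ht : 0 < t) : realModulus t < 1 := by
  rw [realModulus, div_lt_one (pow_pos (realTheta3_pos ht) 2), ← sub_pos]
  have h := realTheta4_sq (half_pos ht)
  rw [mul_div_cancel₀ t two_ne_zero] at h
  rw [← h]
  exact even_two.pow_pos (realTheta4_ne_zero (half_pos ht))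

lemma realTheta3_sq_eq (ht : 0 < t) :
    realTheta3 t ^ 2 = realTheta3 (2 * t) ^ 2 * (1 + realModulus (2 * t)) := by
  have h3 := (realTheta3_pos (mul_pos two_pos ht)).ne'
  rw [realTheta3_sq ht, realModulus]
  field_simp

lemma realModulus_sq_eq (ht : 0 < t) :
    realModulus t ^ 2 = 4 * realModulus (2 * t) / (1 + realModulus (2 * t)) ^ 2 := by
  have h3 := realTheta3_pos (mul_pos two_pos ht)
  have h2 := realTheta2_pos (mul_pos two_pos ht)
  rw [realModulus, realTheta2_sq ht, realTheta3_sq ht, realModulus]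
  field_simp
  ring

/-- Landen's transformation leaves the ratio of `ϑ₃ ^ 2` and the hypergeometric function
invariant. -/
lemma realTheta3_sq_div_ellF (ht : 0 < t) :
    realTheta3 t ^ 2 / ellF (realModulus t ^ 2) =
      realTheta3 (2 * t) ^ 2 / ellF (realModulus (2 * t) ^ 2) := by
  have h2 := mul_pos two_pos ht
  have hk0 := realModulus_pos h2
  have hk1 := realModulus_lt_one h2
  have hne : 1 + realModulus (2 * t) ≠ 0 := by positivity
  rw [realModulus_sq_eq ht, ellF_quadratic hk0.le hk1, realTheta3_sq_eq ht,
    mul_comm (1 + realModulus (2 * t)), mul_div_mul_right _ _ hne]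

end

lemma tendsto_realTheta3_atTop : Tendsto realTheta3 atTop (𝓝 1) := by
  have h1 : Tendsto (fun τ : ℂ => Real.exp (-Real.pi * τ.im)) (comap im atTop) (𝓝 0) := by
    refine (Real.tendsto_exp_atBot.comp ?_).comp tendsto_comap
    exact tendsto_id.const_mul_atTop_of_neg (neg_neg_of_pos Real.pi_pos)
  have h2 := isBigO_at_im_infty_jacobiTheta_sub_one.trans_tendsto h1
  have h3 : Tendsto (fun t : ℝ => 2 * ((t : ℂ) * I)) atTop (comap im atTop) := by
    rw [tendsto_comap_iff]
    refine (tendsto_id.const_mul_atTop two_pos).congr fun t => ?_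
    simp
  have h4 := (h2.comp h3).add_const 1
  rw [zero_add] at h4
  have h5 := (continuous_re.tendsto _).comp h4
  refine h5.congr fun t => ?_
  simp only [Function.comp_apply, sub_add_cancel]
  rw [jacobiTheta_eq_jacobiTheta₂, ← theta3Null_eq, theta3Null_mul_I, ofReal_re]

/-- By `realTheta3_sq` at `t/2`, this is the difference of `ϑ₃^2` at `t/2` and at `t`, both tending
to `1`. -/
lemma tendsto_realTheta2_sq_atTop : Tendsto (fun t => realTheta2 t ^ 2) atTop (𝓝 0) := by
  have h1 := (tendsto_realTheta3_atTop.comp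
    (tendsto_id.atTop_div_const (two_pos : (0 : ℝ) < 2))).pow 2
  have h2 := h1.sub (tendsto_realTheta3_atTop.pow 2)
  rw [sub_self] at h2
  refine h2.congr' ?_
  filter_upwards [eventually_gt_atTop 0] with t ht
  have h := realTheta3_sq (half_pos ht)
  rw [mul_div_cancel₀ t two_ne_zero] at h
  simp only [Function.comp_apply, id]
  rw [h]
  ring

lemma tendsto_realTheta3_sq_div_ellF :
    Tendsto (fun t => realTheta3 t ^ 2 / ellF (realModulus t ^ 2)) atTop (𝓝 1) := by
  have h3 := tendsto_realTheta3_atTop.pow 2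
  rw [one_pow] at h3
  have hk := (tendsto_realTheta2_sq_atTop.div h3 one_ne_zero).pow 2
  rw [zero_div, zero_pow two_ne_zero] at hk
  have hF := continuousAt_ellF_zero.tendsto.comp hk
  rw [ellF_zero] at hF
  have := h3.div hF one_ne_zero
  rwa [one_div_one] at this

/-- Jacobi's formula `ϑ₃ ^ 2 = ₂F₁ (1/2, 1/2; 1; k ^ 2)`. -/
theorem realTheta3_sq_eq_ellF {t : ℝ} (ht : 0 < t) :
    realTheta3 t ^ 2 = ellF (realModulus t ^ 2) := by
  -- Each Landen step doubles `t`; iterating sends `t` to infinity along a sequence on which the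
  -- ratio is constant.
  have hiter : ∀ n : ℕ, realTheta3 (2 ^ n * t) ^ 2 / ellF (realModulus (2 ^ n * t) ^ 2) =
      realTheta3 t ^ 2 / ellF (realModulus t ^ 2) := by
    intro n
    induction n with
    | zero => simp
    | succ n ih =>
      rw [← ih, realTheta3_sq_div_ellF (by positivity : 0 < 2 ^ n * t), pow_succ' (2 : ℝ) n,
        mul_assoc]
  have hlim : Tendsto (fun n : ℕ => (2 : ℝ) ^ n * t) atTop atTop :=
    (tendsto_pow_atTop_atTop_of_one_lt one_lt_two).atTop_mul_const ht
  have h1 : realTheta3 t ^ 2 / ellF (realModulus t ^ 2) = 1 :=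
    tendsto_nhds_unique (tendsto_const_nhds.congr fun n => (hiter n).symm)
      (tendsto_realTheta3_sq_div_ellF.comp hlim)
  have hk := realModulus_pos ht
  have hF := ellF_pos (x := realModulus t ^ 2) (by positivity)
    (pow_lt_one₀ hk.le (realModulus_lt_one ht) two_ne_zero)
  exact (div_eq_one_iff_eq hF.ne').mp h1

theorem isCompleteEllipticIntegral_ellK : IsCompleteEllipticIntegral ellK := by
  refine ⟨fun z hz => ?_, fun t ht => ⟨realModulus t, realModulus_pos ht, realModulus_lt_one ht,
    ?_, ?_⟩⟩
  · have h2 : 0 < (2 * z).im := by simpa using hz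
    have h : DifferentiableAt ℂ theta3Null z := by
      have e : theta3Null = fun z => jacobiTheta₂ 0 (2 * z) := funext theta3Null_eq
      rw [e]
      exact (differentiableAt_jacobiTheta₂_snd 0 h2).comp z (by fun_prop)
    exact ((h.pow 2).const_mul _).differentiableWithinAt
  · rw [modulus, theta2Null_mul_I, theta3Null_mul_I, realModulus]
    push_cast
    rfl
  · rw [ellK, theta3Null_mul_I, ordinaryHypergeometric_half_half_one,
      ← realTheta3_sq_eq_ellF ht]
    push_cast
    rfl

end NomeJacobi

/-! ### The main theorem. -/

theorem theorem18 (a x y : ℝ) (ha0 : 0 < a) (ha1 : a < 1) (hy : 0 < y)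
    (z K θ₁ θ₂ θ₀ : ℂ) (hz : z = x + y * Complex.I) (hK : K = NomeJacobi.ellK z)
    (hθ₁ : θ₁ = -K + (4 * a - 2) * x * K) (hθ₂ : θ₂ = (4 * a - 2) * y * K)
    (hθ₀ : θ₀ = θ₁ + Complex.I * θ₂) :
    NomeJacobi.IsCompleteEllipticIntegral NomeJacobi.ellK ∧
    NomeJacobi.qpow z a =
      Complex.I * NomeJacobi.qpow z (1 / 2) *
        Complex.exp (Complex.I * Real.pi * θ₀ / (2 * K)) ∧
    Summable (fun n : ℕ => NomeJacobi.arctanh (NomeJacobi.qpow z ((n : ℂ) + a))) ∧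
    ∃ L : ℂ,
      NomeJacobi.IsLogFromZero
        (fun u => NomeJacobi.nd z u + NomeJacobi.modulus z * NomeJacobi.sd z u) θ₀ L ∧
      HasSum
        (fun n : ℕ =>
          (-1 : ℂ) ^ n * NomeJacobi.qpow z ((n : ℂ) + 1 / 2) /
              ((2 * (n : ℂ) + 1) * (1 - NomeJacobi.qpow z (2 * (n : ℂ) + 1))) *
            Complex.cos ((2 * (n : ℂ) + 1) * (Real.pi / (2 * K)) * θ₀))
        (1 / (2 * Complex.I) * NomeJacobi.modularAngle z a + 1 / (4 * Complex.I) * L) := by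
  have him : z.im = y := by simp [hz]
  have hzim : 0 < z.im := by rwa [him]
  have hK0 : K ≠ 0 := hK ▸ NomeJacobi.ellK_ne_zero hzim
  have hv : Real.pi * θ₀ / (2 * K) = Real.pi / 2 * (-1 + (4 * a - 2) * z) := by
    rw [hθ₀, hθ₁, hθ₂, hz]
    field_simp
    ring
  -- The imaginary part is `π (2a - 1) Im z`, and `|2a - 1| < 1` is where `0 < a < 1` enters.
  have hvim : |(Real.pi * θ₀ / (2 * K)).im| < Real.pi * z.im := by
    have e : Real.pi / 2 * (-1 + (4 * a - 2) * z) =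
        ((-(Real.pi / 2) : ℝ) : ℂ) + ((Real.pi * (2 * a - 1) : ℝ) : ℂ) * z := by
      push_cast
      ring
    rw [hv, e, Complex.add_im, Complex.ofReal_im, Complex.im_ofReal_mul, zero_add, abs_mul,
      abs_mul, abs_of_pos Real.pi_pos, abs_of_pos hzim, mul_assoc]
    refine mul_lt_mul_of_pos_left (mul_lt_of_lt_one_left hzim ?_) Real.pi_pos
    rw [abs_lt]
    constructor <;> linarith
  obtain ⟨hsummable, hsum⟩ := NomeJacobi.hasSum_lambert_of_modularAngle hzim hvim hv
  refine ⟨NomeJacobi.isCompleteEllipticIntegral_ellK, ?_, hsummable, _,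
    NomeJacobi.isLogFromZero_nd_add_modulus_mul_sd hzim (by rw [← hK]) hvim, ?_⟩
  -- The formula for `q^a` is the case `k = 0` of `w_k(v) = q^(k+a)`.
  · have h := NomeJacobi.nomeArg_eq_qpow z a 0
    rw [← hv, NomeJacobi.nomeArg, Nat.cast_zero, zero_add, zero_add] at h
    rw [← h]
    congr 2
    ring
  · refine hsum.congr_fun fun n => ?_
    congr 2
    ring
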